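/- Let $0<h_1<h_2<\pi$, let $\delta,\theta$ be nonzero real numbers, and put $J=[0,h_1)\cup(h_1,h_2)\cup(h_2,\pi]$. Let $q:J\to\mathbb{R}$ and $\Delta:J\to[0,\infty)$ be continuous with finite one-sided limits at $h_1$ and $h_2$, with $x-\Delta(x)\ge 0$ on $[0,h_1)$, $x-\Delta(x)\ge h_1$ on $(h_1,h_2)$ and $x-\Delta(x)\ge h_2$ on $(h_2,\pi)$. A number $\mu>0$ is called an eigenvalue if the problem $$y''(x)+q(x)\,y(x-\Delta(x))+\mu^2y(x)=0,\qquad x\in J,$$ $$\mu y(0)+y'(0)=0,\qquad \mu^2y(\pi)+y'(\pi)=0,$$ $$y(h_1-0)=\delta\,y(h_1+0),\quad y'(h_1-0)=\delta\,y'(h_1+0),\quad y(h_2-0)=\theta\,y(h_2+0),\quad y'(h_2-0)=\theta\,y'(h_2+0)$$ has a solution $y$ that is not identically zero on $J$ (where $y(x-\Delta(x))$ means $y(h_i+0)$ if $x-\Delta(x)=h_i$). Assume (a) $q'$ and $\Delta''$ exist and are bounded on $J$ and have finite one-sided limits at $h_1$ and $h_2$; (b) $\Delta'\le 1$ on $J$,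 and $\Delta(0)=\Delta(h_1+0)=\Delta(h_2+0)=0$. Then for every sufficiently large natural number $N$ there is exactly one eigenvalue $\mu_N$ with $\left|N+\frac14-\mu_N\right|<\frac14$, and $$\mu_N=N+\frac14-\frac{2}{\pi(4N+1)}\left(2+\int_0^\pi q(\tau)\cos\left(\left(N+\tfrac14\right)\Delta(\tau)\right)d\tau\right)+O\left(\frac1{N^2}\right)\qquad(N\to\infty).$$ -/

import Mathlib

open Set Filter Topology Asymptotics

/-- The domain `[0, h₁) ∪ (h₁, h₂) ∪ (h₂, π]`. -/
def pieces (h₁ h₂ : ℝ) : Set ℝ := Ico 0 h₁ ∪ Ioo h₁ h₂ ∪ Ioc h₂ Real.pi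

/-- `f` has finite one-sided limits `f (h - 0)` and `f (h + 0)`. -/
def HasOneSidedLimits (f : ℝ → ℝ) (h : ℝ) : Prop :=
  (∃ l, Tendsto f (𝓝[<] h) (𝓝 l)) ∧ (∃ r, Tendsto f (𝓝[>] h) (𝓝 r))

/-- The transmission condition `f (h - 0) - c * f (h + 0) = 0` (both limits exist). -/
def Transmission (f : ℝ → ℝ) (h c : ℝ) : Prop :=
  ∃ l r, Tendsto f (𝓝[<] h) (𝓝 l) ∧ Tendsto f (𝓝[>] h) (𝓝 r) ∧ l - c * r = 0

/-- The data of the boundary value problem with retarded argument: potential `q`, delay `Δ`,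
interior points `h₁ < h₂`, transmission coefficients `δ`, `θ`. The values of `q` and `Δ` at
`h₁`, `h₂` and outside `[0, π]` play no role. -/
structure RetardedProblem where
  q : ℝ → ℝ
  Δ : ℝ → ℝ
  h₁ : ℝ
  h₂ : ℝ
  δ : ℝ
  θ : ℝ
  h₁_pos : 0 < h₁
  h₁_lt_h₂ : h₁ < h₂
  h₂_lt_pi : h₂ < Real.pi
  δ_ne_zero : δ ≠ 0
  θ_ne_zero : θ ≠ 0
  q_continuousOn : ContinuousOn q (pieces h₁ h₂)
  q_limits₁ : HasOneSidedLimits q h₁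
  q_limits₂ : HasOneSidedLimits q h₂
  Δ_nonneg : ∀ x ∈ pieces h₁ h₂, 0 ≤ Δ x
  Δ_continuousOn : ContinuousOn Δ (pieces h₁ h₂)
  Δ_limits₁ : HasOneSidedLimits Δ h₁
  Δ_limits₂ : HasOneSidedLimits Δ h₂
  delay₁ : ∀ x ∈ Ico 0 h₁, 0 ≤ x - Δ x
  delay₂ : ∀ x ∈ Ioo h₁ h₂, h₁ ≤ x - Δ x
  delay₃ : ∀ x ∈ Ioo h₂ Real.pi, h₂ ≤ x - Δ x

namespace RetardedProblem

/-- The domain of the differential equation of the problem `P`. -/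
def domain (P : RetardedProblem) : Set ℝ := pieces P.h₁ P.h₂

/-- `y` is an eigenfunction of the problem with parameter `μ`: a nontrivial classical solution of
`y''(x) + q(x) y(x - Δ(x)) + μ² y(x) = 0` on the domain, with the two boundary and four
transmission conditions. For `x` in the second (third) piece, `x - Δ(x)` may equal `h₁` (`h₂`);
the retarded value then is `y(h₁ + 0)` (`y(h₂ + 0)`), which is what `y h₁` and `y h₂` stand for
by the fields `right₁`, `right₂`. The other values of `y` off the domain play no role.
The functions `y'` and `y''` are the first and second derivatives of `y` on the domain. -/
structure IsEigenfunctionWith (P : RetardedProblem) (μ : ℝ) (y y' y'' : ℝ → ℝ) : Prop where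
  hasDeriv : ∀ x ∈ P.domain, HasDerivWithinAt y (y' x) P.domain x
  hasDeriv' : ∀ x ∈ P.domain, HasDerivWithinAt y' (y'' x) P.domain x
  equation : ∀ x ∈ P.domain, y'' x + P.q x * y (x - P.Δ x) + μ ^ 2 * y x = 0
  right₁ : Tendsto y (𝓝[>] P.h₁) (𝓝 (y P.h₁))
  right₂ : Tendsto y (𝓝[>] P.h₂) (𝓝 (y P.h₂))
  boundary_zero : μ * y 0 + y' 0 = 0
  boundary_pi : μ ^ 2 * y Real.pi + y' Real.pi = 0
  transmission₁ : Transmission y P.h₁ P.δ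
  transmission₁' : Transmission y' P.h₁ P.δ
  transmission₂ : Transmission y P.h₂ P.θ
  transmission₂' : Transmission y' P.h₂ P.θ
  nontrivial : ∃ x ∈ P.domain, y x ≠ 0

/-- The positive number `μ` is an eigenvalue (of the eigenparameter) of the problem. -/
def IsEigenvalue (P : RetardedProblem) (μ : ℝ) : Prop :=
  0 < μ ∧ ∃ y y' y'' : ℝ → ℝ, P.IsEigenfunctionWith μ y y' y''

/-- `μ` is the unique eigenvalue with `|N + 1/4 - μ| < 1/4`. -/
def IsTheEigenvalueNear (P : RetardedProblem) (N : ℕ) (μ : ℝ) : Prop :=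
  (P.IsEigenvalue μ ∧ |(N : ℝ) + 1 / 4 - μ| < 1 / 4) ∧
    ∀ ν, P.IsEigenvalue ν → |(N : ℝ) + 1 / 4 - ν| < 1 / 4 → ν = μ

/-- Condition a: `q'` and `Δ''` exist and are bounded on the domain and have finite one-sided
limits at `h₁` and `h₂`. -/
structure ConditionA (P : RetardedProblem) : Prop where
  q_diff : DifferentiableOn ℝ P.q P.domain
  q'_bounded : ∃ M, ∀ x ∈ P.domain, |derivWithin P.q P.domain x| ≤ M
  q'_limits₁ : HasOneSidedLimits (derivWithin P.q P.domain) P.h₁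
  q'_limits₂ : HasOneSidedLimits (derivWithin P.q P.domain) P.h₂
  Δ_diff : DifferentiableOn ℝ P.Δ P.domain
  Δ'_diff : DifferentiableOn ℝ (derivWithin P.Δ P.domain) P.domain
  Δ''_bounded : ∃ M, ∀ x ∈ P.domain,
    |derivWithin (derivWithin P.Δ P.domain) P.domain x| ≤ M
  Δ''_limits₁ : HasOneSidedLimits (derivWithin (derivWithin P.Δ P.domain) P.domain) P.h₁
  Δ''_limits₂ : HasOneSidedLimits (derivWithin (derivWithin P.Δ P.domain) P.domain) P.h₂

/-- Condition b: `Δ' ≤ 1` on the domain and `Δ(0) = Δ(h₁ + 0) = Δ(h₂ + 0) = 0`. -/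
structure ConditionB (P : RetardedProblem) : Prop where
  Δ'_le_one : ∀ x ∈ P.domain, derivWithin P.Δ P.domain x ≤ 1
  Δ_zero : P.Δ 0 = 0
  Δ_right₁ : Tendsto P.Δ (𝓝[>] P.h₁) (𝓝 0)
  Δ_right₂ : Tendsto P.Δ (𝓝[>] P.h₂) (𝓝 0)

end RetardedProblem

/-! Multiplying `y` by 1, δ and δθ on the three pieces turns the transmission conditions into
continuity of the function and of its derivative. Since `x - Δ x` never leaves the piece of `x`, the
scaled function `z` still satisfies the equation, now on all of [0, π] away from the two nodes. The
problem loses δ and θ and becomes z'' + Q z(σ) + μ² z = 0 with z(0) = c, z'(0) = -μc.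

Variation of constants gives z = c(cos μx - sin μx) - (1/μ) ∫ Q(τ) sin(μ(x - τ)) z(σ τ) dτ. For μ ≥
2 ∫ |Q| the integral operator has norm at most 1/2, so there is exactly one solution for each c, and
the condition at π becomes cos μπ - sin μπ = E(μ)/μ (`isEigenvalue_iff`), where E is bounded and
Lipschitz for large μ.

At μ = N + 1/4 + ε the left side is -(-1)^N √2 sin πε. It dominates E/μ at the ends of the window,
which gives a zero (`exists_zero_near`), and it expands distances more than E/μ does, which makes
the zero unique (`zero_near_unique`).

For the asymptotics, `z` in E may be replaced by cos - sin at the cost of O(1/μ). Products of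
trigonometric functions then split into terms with phase μ(τ - σ) = μΔ, which survive, and terms
with phase μ(τ + σ) = μ(2τ - Δ). The latter phase has derivative at least μ because Δ' ≤ 1, so
integration by parts makes these terms O(1/μ) (`abs_integral_potential_mul_sin_le`). The equation
for sin πε yields first ε = O(1/N) and then, after substituting this back, the stated expansion
(`abs_zero_near_sub_le`). -/

/-! ### The Volterra equation with retarded argument: existence, bounds, uniqueness. -/

section Volterra

open MeasureTheory BoundedContinuousFunction

/-- `z` solves on `[0, π]` the Volterra equation of `z'' + Q z(σ ·) + μ² z = 0` with initial values
`z 0 = c` and `z' 0 = -μ c`. -/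
structure IsVolterraSolution (Q σ : ℝ → ℝ) (μ c : ℝ) (z : ℝ → ℝ) : Prop where
  continuousOn : ContinuousOn z (Icc 0 Real.pi)
  eq : ∀ x ∈ Icc (0 : ℝ) Real.pi, z x = c * (Real.cos (μ * x) - Real.sin (μ * x)) -
    1 / μ * ∫ τ in (0 : ℝ)..x, Q τ * (Real.sin (μ * (x - τ)) * z (σ τ))

theorem measurable_comp_of_continuousOn_Icc {σ z : ℝ → ℝ} (hσ : Measurable σ)
    (hmap : ∀ t, σ t ∈ Icc (0 : ℝ) Real.pi) (hz : ContinuousOn z (Icc 0 Real.pi)) :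
    Measurable fun t => z (σ t) := by
  have h : Continuous (IccExtend Real.pi_pos.le (domRestrict (Icc 0 Real.pi) z)) :=
    (continuousOn_iff_continuous_domRestrict.mp hz).Icc_extend'
  have h2 : (fun t => z (σ t)) =
      fun t => IccExtend Real.pi_pos.le (domRestrict (Icc 0 Real.pi) z) (σ t) := by
    funext t
    rw [IccExtend_of_mem _ _ (hmap t)]
    rfl
  rw [h2]
  exact h.measurable.comp hσ

theorem integrable_mul_of_abs_le {Q w : ℝ → ℝ} {C : ℝ} (hQ : Integrable Q) (hw : Measurable w)
    (hC : ∀ t, |w t| ≤ C) : Integrable fun t => Q t * w t :=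
  hQ.mul_bdd (c := C) hw.aestronglyMeasurable (Eventually.of_forall hC)

theorem abs_intervalIntegral_mul_le {Q w : ℝ → ℝ} {C a b : ℝ} (hQ : Integrable Q) (hC0 : 0 ≤ C)
    (hC : ∀ t, |w t| ≤ C) : |∫ t in a..b, Q t * w t| ≤ (∫ t, |Q t|) * C := by
  have h1 : |∫ t in a..b, Q t * w t| ≤ ∫ t in uIoc a b, |Q t| * C := by
    rw [← Real.norm_eq_abs]
    refine (intervalIntegral.norm_integral_le_integral_norm_uIoc).trans ?_
    refine integral_mono_of_nonneg (Eventually.of_forall fun _ => norm_nonneg _)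
      ((hQ.abs.mul_const C).integrableOn) (Eventually.of_forall fun t => ?_)
    simp only [norm_mul, Real.norm_eq_abs]
    exact mul_le_mul_of_nonneg_left (hC t) (abs_nonneg _)
  refine h1.trans ?_
  rw [← integral_mul_const]
  exact setIntegral_le_integral (hQ.abs.mul_const C)
    (Eventually.of_forall fun t => mul_nonneg (abs_nonneg _) hC0)

theorem integral_mul_sin_sub {g : ℝ → ℝ} (hg : Integrable g) (μ x y : ℝ) :
    ∫ τ in (0 : ℝ)..x, g τ * Real.sin (μ * (y - τ)) =
      Real.sin (μ * y) * (∫ τ in (0 : ℝ)..x, g τ * Real.cos (μ * τ)) -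
      Real.cos (μ * y) * ∫ τ in (0 : ℝ)..x, g τ * Real.sin (μ * τ) := by
  have hc : Integrable fun τ => g τ * Real.cos (μ * τ) :=
    integrable_mul_of_abs_le hg (by fun_prop) fun t => Real.abs_cos_le_one _
  have hs : Integrable fun τ => g τ * Real.sin (μ * τ) :=
    integrable_mul_of_abs_le hg (by fun_prop) fun t => Real.abs_sin_le_one _
  rw [← intervalIntegral.integral_const_mul, ← intervalIntegral.integral_const_mul,
    ← intervalIntegral.integral_sub (hc.const_mul _).intervalIntegrable
      (hs.const_mul _).intervalIntegrable]
  congr 1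
  funext τ
  rw [mul_sub, Real.sin_sub]
  ring

theorem integral_mul_cos_sub {g : ℝ → ℝ} (hg : Integrable g) (μ x y : ℝ) :
    ∫ τ in (0 : ℝ)..x, g τ * Real.cos (μ * (y - τ)) =
      Real.cos (μ * y) * (∫ τ in (0 : ℝ)..x, g τ * Real.cos (μ * τ)) +
      Real.sin (μ * y) * ∫ τ in (0 : ℝ)..x, g τ * Real.sin (μ * τ) := by
  have hc : Integrable fun τ => g τ * Real.cos (μ * τ) :=
    integrable_mul_of_abs_le hg (by fun_prop) fun t => Real.abs_cos_le_one _
  have hs : Integrable fun τ => g τ * Real.sin (μ * τ) :=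
    integrable_mul_of_abs_le hg (by fun_prop) fun t => Real.abs_sin_le_one _
  rw [← intervalIntegral.integral_const_mul, ← intervalIntegral.integral_const_mul,
    ← intervalIntegral.integral_add (hc.const_mul _).intervalIntegrable
      (hs.const_mul _).intervalIntegrable]
  congr 1
  funext τ
  rw [mul_sub, Real.cos_sub]
  ring

theorem continuous_integral_mul_sin_sub {g : ℝ → ℝ} (hg : Integrable g) (μ : ℝ) :
    Continuous fun x => ∫ τ in (0 : ℝ)..x, g τ * Real.sin (μ * (x - τ)) := by
  have hc : Integrable fun τ => g τ * Real.cos (μ * τ) :=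
    integrable_mul_of_abs_le hg (by fun_prop) fun t => Real.abs_cos_le_one _
  have hs : Integrable fun τ => g τ * Real.sin (μ * τ) :=
    integrable_mul_of_abs_le hg (by fun_prop) fun t => Real.abs_sin_le_one _
  have h : (fun x => ∫ τ in (0 : ℝ)..x, g τ * Real.sin (μ * (x - τ))) = fun x =>
      Real.sin (μ * x) * (∫ τ in (0 : ℝ)..x, g τ * Real.cos (μ * τ)) -
      Real.cos (μ * x) * ∫ τ in (0 : ℝ)..x, g τ * Real.sin (μ * τ) :=
    funext fun x => integral_mul_sin_sub hg μ x x
  have h1 := intervalIntegral.continuous_primitive (fun a b => hc.intervalIntegrable) 0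
  have h2 := intervalIntegral.continuous_primitive (fun a b => hs.intervalIntegrable) 0
  rw [h]
  fun_prop

theorem abs_sin_mul_le {w : ℝ → ℝ} {S : ℝ} (s : ℝ → ℝ) (hS : ∀ t, |w t| ≤ S) (t : ℝ) :
    |Real.sin (s t) * w t| ≤ S := by
  rw [abs_mul]
  exact (mul_le_of_le_one_left (abs_nonneg _) (Real.abs_sin_le_one _)).trans (hS t)

theorem abs_cos_mul_le {w : ℝ → ℝ} {S : ℝ} (s : ℝ → ℝ) (hS : ∀ t, |w t| ≤ S) (t : ℝ) :
    |Real.cos (s t) * w t| ≤ S := by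
  rw [abs_mul]
  exact (mul_le_of_le_one_left (abs_nonneg _) (Real.abs_cos_le_one _)).trans (hS t)

theorem abs_cos_sub_sin_le (a : ℝ) : |Real.cos a - Real.sin a| ≤ 2 := by
  have h1 := abs_le.mp (Real.abs_cos_le_one a)
  have h2 := abs_le.mp (Real.abs_sin_le_one a)
  exact abs_le.mpr ⟨by linarith, by linarith⟩

/-- Banach's fixed point theorem for bounded continuous functions on the whole line: integrability
of `Q` on ℝ keeps the integral bounded, and `μ ≥ 2 ∫ |Q|` makes 1/2 a contraction constant. -/
theorem exists_isVolterraSolution {Q σ : ℝ → ℝ} (hQ : Integrable Q) (hσ : Measurable σ)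
    {μ : ℝ} (hμ : 0 < μ) (hμQ : 2 * (∫ t, |Q t|) ≤ μ) :
    ∃ z, IsVolterraSolution Q σ μ 1 z := by
  have hint : ∀ z : ℝ →ᵇ ℝ, Integrable fun τ => Q τ * z (σ τ) := fun z =>
    integrable_mul_of_abs_le hQ (z.continuous.measurable.comp hσ) fun t => z.norm_coe_le_norm _
  have hbound : ∀ (z : ℝ →ᵇ ℝ) (x : ℝ),
      |∫ τ in (0 : ℝ)..x, Q τ * (Real.sin (μ * (x - τ)) * z (σ τ))| ≤ (∫ t, |Q t|) * ‖z‖ :=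
    fun z x => abs_intervalIntegral_mul_le hQ (norm_nonneg _)
      (abs_sin_mul_le _ fun t => z.norm_coe_le_norm (σ t))
  have hcont : ∀ z : ℝ →ᵇ ℝ, Continuous fun x => 1 * (Real.cos (μ * x) - Real.sin (μ * x)) -
      1 / μ * ∫ τ in (0 : ℝ)..x, Q τ * (Real.sin (μ * (x - τ)) * z (σ τ)) := by
    intro z
    have h := continuous_integral_mul_sin_sub (hint z) μ
    have h' : (fun x => ∫ τ in (0 : ℝ)..x, Q τ * (Real.sin (μ * (x - τ)) * z (σ τ))) =
        fun x => ∫ τ in (0 : ℝ)..x, Q τ * z (σ τ) * Real.sin (μ * (x - τ)) := by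
      funext x
      congr 1
      funext τ
      ring
    rw [← h'] at h
    fun_prop
  let T : (ℝ →ᵇ ℝ) → (ℝ →ᵇ ℝ) := fun z => BoundedContinuousFunction.ofNormedAddCommGroup _
    (hcont z) (2 + 1 / μ * ((∫ t, |Q t|) * ‖z‖)) (by
      intro x
      rw [Real.norm_eq_abs, one_mul]
      refine (abs_sub _ _).trans (add_le_add (abs_cos_sub_sin_le _) ?_)
      rw [abs_mul, abs_of_pos (one_div_pos.mpr hμ)]
      exact mul_le_mul_of_nonneg_left (hbound z x) (one_div_pos.mpr hμ).le)
  have hT : ContractingWith (1 / 2) T := by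
    refine ⟨by norm_num [← NNReal.coe_lt_coe], LipschitzWith.of_dist_le_mul fun z w => ?_⟩
    rw [dist_eq_norm, dist_eq_norm]
    refine (BoundedContinuousFunction.norm_le (by positivity)).mpr fun x => ?_
    have h : (T z - T w) x =
        -(1 / μ * ∫ τ in (0 : ℝ)..x, Q τ * (Real.sin (μ * (x - τ)) * (z - w) (σ τ))) := by
      have hI : ∀ v : ℝ →ᵇ ℝ, IntervalIntegrable
          (fun τ => Q τ * (Real.sin (μ * (x - τ)) * v (σ τ))) volume 0 x := fun v =>
        (integrable_mul_of_abs_le hQ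
          (Measurable.mul (by fun_prop) (v.continuous.measurable.comp hσ))
          (abs_sin_mul_le _ fun t => v.norm_coe_le_norm (σ t))).intervalIntegrable
      have hsub : ∫ τ in (0 : ℝ)..x, Q τ * (Real.sin (μ * (x - τ)) * (z - w) (σ τ)) =
          (∫ τ in (0 : ℝ)..x, Q τ * (Real.sin (μ * (x - τ)) * z (σ τ))) -
          ∫ τ in (0 : ℝ)..x, Q τ * (Real.sin (μ * (x - τ)) * w (σ τ)) := by
        rw [← intervalIntegral.integral_sub (hI z) (hI w)]
        congr 1
        funext τ
        simp only [BoundedContinuousFunction.coe_sub, Pi.sub_apply]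
        ring
      rw [hsub]
      simp only [T, BoundedContinuousFunction.coe_sub, Pi.sub_apply,
        BoundedContinuousFunction.coe_ofNormedAddCommGroup]
      ring
    rw [h, norm_neg, Real.norm_eq_abs, abs_mul, abs_of_pos (one_div_pos.mpr hμ)]
    have h2 := hbound (z - w) x
    have h3 : 1 / μ * (∫ t, |Q t|) ≤ 1 / 2 := by
      rw [one_div_mul_eq_div, div_le_iff₀ hμ]
      linarith
    calc 1 / μ * |∫ τ in (0 : ℝ)..x, Q τ * (Real.sin (μ * (x - τ)) * (z - w) (σ τ))|
        ≤ 1 / μ * ((∫ t, |Q t|) * ‖z - w‖) := by gcongr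
      _ = (1 / μ * (∫ t, |Q t|)) * ‖z - w‖ := by ring
      _ ≤ 1 / 2 * ‖z - w‖ := by gcongr
      _ = _ := by push_cast; rfl
  refine ⟨hT.fixedPoint, hT.fixedPoint.continuous.continuousOn, fun x _ => ?_⟩
  have h := congrArg (fun z : ℝ →ᵇ ℝ => z x) hT.fixedPoint_isFixedPt
  exact h.symm

/-- Taking for `S` the maximum of `|w|` gives S ≤ a + S/2. All a priori bounds below come from this
absorption, with S/2 supplied by the integral term. -/
theorem abs_le_of_forall_abs_le_add_half {w : ℝ → ℝ} (hw : ContinuousOn w (Icc 0 Real.pi)) {a : ℝ}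
    (h : ∀ S, 0 ≤ S → (∀ t ∈ Icc (0 : ℝ) Real.pi, |w t| ≤ S) →
      ∀ x ∈ Icc (0 : ℝ) Real.pi, |w x| ≤ a + S / 2) :
    ∀ x ∈ Icc (0 : ℝ) Real.pi, |w x| ≤ 2 * a := by
  obtain ⟨x₀, hx₀, hmax⟩ := isCompact_Icc.exists_isMaxOn
    (nonempty_Icc.mpr Real.pi_pos.le) hw.abs
  have h1 := h |w x₀| (abs_nonneg _) (fun t ht => hmax ht) x₀ hx₀
  intro x hx
  have h2 : |w x| ≤ |w x₀| := hmax hx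
  linarith

variable {Q σ : ℝ → ℝ} {μ ν c d : ℝ} {z w : ℝ → ℝ}

theorem IsVolterraSolution.integrable (hz : IsVolterraSolution Q σ μ c z) (hQ : Integrable Q)
    (hσ : Measurable σ) (hmap : ∀ t, σ t ∈ Icc (0 : ℝ) Real.pi) :
    Integrable fun τ => Q τ * z (σ τ) := by
  obtain ⟨C, hC⟩ := isCompact_Icc.exists_bound_of_continuousOn hz.continuousOn
  exact integrable_mul_of_abs_le hQ (measurable_comp_of_continuousOn_Icc hσ hmap hz.continuousOn)
    fun t => hC _ (hmap t)

theorem IsVolterraSolution.abs_apply_le (hz : IsVolterraSolution Q σ μ 1 z) (hQ : Integrable Q)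
    (hmap : ∀ t, σ t ∈ Icc (0 : ℝ) Real.pi) (hμ : 0 < μ) (hμQ : 2 * (∫ t, |Q t|) ≤ μ) :
    ∀ x ∈ Icc (0 : ℝ) Real.pi, |z x| ≤ 4 := by
  have h := abs_le_of_forall_abs_le_add_half (a := 2) hz.continuousOn fun S hS0 hS x hx => ?_
  · intro x hx
    linarith [h x hx]
  · rw [hz.eq x hx, one_mul]
    refine (abs_sub _ _).trans (add_le_add (abs_cos_sub_sin_le _) ?_)
    rw [abs_mul, abs_of_pos (one_div_pos.mpr hμ)]
    have h2 : |∫ τ in (0 : ℝ)..x, Q τ * (Real.sin (μ * (x - τ)) * z (σ τ))| ≤ (∫ t, |Q t|) * S :=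
      abs_intervalIntegral_mul_le hQ hS0 (abs_sin_mul_le _ fun t => hS _ (hmap t))
    rw [one_div_mul_eq_div, div_le_iff₀ hμ]
    nlinarith

theorem IsVolterraSolution.smul_sub_smul (hz : IsVolterraSolution Q σ μ c z)
    (hw : IsVolterraSolution Q σ μ d w) (hQ : Integrable Q)
    (hσ : Measurable σ) (hmap : ∀ t, σ t ∈ Icc (0 : ℝ) Real.pi) (a b : ℝ) :
    IsVolterraSolution Q σ μ (a * c - b * d) fun x => a * z x - b * w x := by
  refine ⟨(hz.continuousOn.const_mul a).sub (hw.continuousOn.const_mul b), fun x hx => ?_⟩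
  have hI : ∀ {v : ℝ → ℝ}, Integrable (fun τ => Q τ * v (σ τ)) → IntervalIntegrable
      (fun τ => Q τ * (Real.sin (μ * (x - τ)) * v (σ τ))) volume 0 x := fun {v} hv => by
    have := integrable_mul_of_abs_le hv (w := fun τ => Real.sin (μ * (x - τ)))
      (by fun_prop) (fun t => Real.abs_sin_le_one _)
    refine (this.congr (Eventually.of_forall fun τ => ?_)).intervalIntegrable
    simp only
    ring
  have h : ∫ τ in (0 : ℝ)..x, Q τ * (Real.sin (μ * (x - τ)) * (a * z (σ τ) - b * w (σ τ))) =
      a * (∫ τ in (0 : ℝ)..x, Q τ * (Real.sin (μ * (x - τ)) * z (σ τ))) -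
      b * ∫ τ in (0 : ℝ)..x, Q τ * (Real.sin (μ * (x - τ)) * w (σ τ)) := by
    rw [← intervalIntegral.integral_const_mul, ← intervalIntegral.integral_const_mul,
      ← intervalIntegral.integral_sub ((hI (hz.integrable hQ hσ hmap)).const_mul a)
      ((hI (hw.integrable hQ hσ hmap)).const_mul b)]
    congr 1
    funext τ
    ring
  simp only [h]
  rw [hz.eq x hx, hw.eq x hx]
  ring

/-- Absorption with a = 0. Together with linearity this is uniqueness for every initial value. -/
theorem IsVolterraSolution.eq_zero (hz : IsVolterraSolution Q σ μ 0 z) (hQ : Integrable Q)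
    (hmap : ∀ t, σ t ∈ Icc (0 : ℝ) Real.pi) (hμ : 0 < μ) (hμQ : 2 * (∫ t, |Q t|) ≤ μ) :
    ∀ x ∈ Icc (0 : ℝ) Real.pi, z x = 0 := by
  have h := abs_le_of_forall_abs_le_add_half (a := 0) hz.continuousOn fun S hS0 hS x hx => ?_
  · intro x hx
    have := h x hx
    rw [mul_zero] at this
    exact abs_nonpos_iff.mp this
  · rw [hz.eq x hx, zero_mul, zero_sub, zero_add, abs_neg]
    rw [abs_mul, abs_of_pos (one_div_pos.mpr hμ)]
    have h2 : |∫ τ in (0 : ℝ)..x, Q τ * (Real.sin (μ * (x - τ)) * z (σ τ))| ≤ (∫ t, |Q t|) * S :=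
      abs_intervalIntegral_mul_le hQ hS0 (abs_sin_mul_le _ fun t => hS _ (hmap t))
    rw [one_div_mul_eq_div, div_le_iff₀ hμ]
    nlinarith

theorem IsVolterraSolution.eq_mul (hz : IsVolterraSolution Q σ μ c z)
    (hw : IsVolterraSolution Q σ μ 1 w) (hQ : Integrable Q)
    (hσ : Measurable σ) (hmap : ∀ t, σ t ∈ Icc (0 : ℝ) Real.pi) (hμ : 0 < μ)
    (hμQ : 2 * (∫ t, |Q t|) ≤ μ) :
    ∀ x ∈ Icc (0 : ℝ) Real.pi, z x = c * w x := by
  have h := hz.smul_sub_smul hw hQ hσ hmap 1 c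
  rw [one_mul, mul_one, sub_self] at h
  intro x hx
  have := h.eq_zero hQ hmap hμ hμQ x hx
  linarith

end Volterra

/-! ### Dependence of the solution and of the characteristic function on μ. -/

section VolterraLipschitz

open MeasureTheory

theorem abs_intervalIntegral_mul_le_of_mem {Q w : ℝ → ℝ} {C x : ℝ} (hQ : Integrable Q)
    (hx : x ∈ Icc (0 : ℝ) Real.pi) (hC0 : 0 ≤ C) (hC : ∀ t ∈ Icc (0 : ℝ) Real.pi, |w t| ≤ C) :
    |∫ t in (0 : ℝ)..x, Q t * w t| ≤ (∫ t, |Q t|) * C := by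
  have h : ∫ t in (0 : ℝ)..x, Q t * w t =
      ∫ t in (0 : ℝ)..x, Q t * (Icc (0 : ℝ) Real.pi).indicator w t := by
    refine intervalIntegral.integral_congr fun t ht => ?_
    rw [uIcc_of_le hx.1] at ht
    simp only [indicator_of_mem (show t ∈ Icc (0 : ℝ) Real.pi from ⟨ht.1, ht.2.trans hx.2⟩)]
  rw [h]
  refine abs_intervalIntegral_mul_le hQ hC0 fun t => ?_
  by_cases ht : t ∈ Icc (0 : ℝ) Real.pi
  · rw [indicator_of_mem ht]
    exact hC t ht
  · rw [indicator_of_notMem ht, abs_zero]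
    exact hC0

variable {Q σ f : ℝ → ℝ} {μ ν : ℝ} {z w : ℝ → ℝ}

/-- The kernel and the solution are varied one at a time; the kernel moves by at most π|μ - ν| and
multiplies `w`, which is bounded by 4. The function `f` is abstract so as to serve both sine and
cosine. -/
theorem abs_integral_kernel_sub_le (hQ : Integrable Q) (hmap : ∀ t, σ t ∈ Icc (0 : ℝ) Real.pi)
    (hfm : Measurable f) (hf1 : ∀ t, |f t| ≤ 1) (hfL : ∀ s t, |f s - f t| ≤ |s - t|)
    (hz : Integrable fun τ => Q τ * z (σ τ)) (hw : Integrable fun τ => Q τ * w (σ τ))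
    (hw4 : ∀ t ∈ Icc (0 : ℝ) Real.pi, |w t| ≤ 4) {S : ℝ} (hS0 : 0 ≤ S)
    (hS : ∀ t ∈ Icc (0 : ℝ) Real.pi, |z t - w t| ≤ S) {x : ℝ} (hx : x ∈ Icc (0 : ℝ) Real.pi) :
    |(∫ τ in (0 : ℝ)..x, Q τ * (f (μ * (x - τ)) * z (σ τ))) -
      ∫ τ in (0 : ℝ)..x, Q τ * (f (ν * (x - τ)) * w (σ τ))| ≤
      (∫ t, |Q t|) * (S + 4 * Real.pi * |μ - ν|) := by
  have hI : ∀ {v : ℝ → ℝ} (ρ : ℝ), Integrable (fun τ => Q τ * v (σ τ)) → IntervalIntegrable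
      (fun τ => Q τ * (f (ρ * (x - τ)) * v (σ τ))) volume 0 x := fun {v} ρ hv => by
    have := integrable_mul_of_abs_le hv (w := fun τ => f (ρ * (x - τ)))
      (by fun_prop) (fun t => hf1 _)
    refine (this.congr (Eventually.of_forall fun τ => ?_)).intervalIntegrable
    simp only
    ring
  rw [← intervalIntegral.integral_sub (hI μ hz) (hI ν hw)]
  simp only [← mul_sub]
  refine abs_intervalIntegral_mul_le_of_mem hQ hx (by positivity) fun t ht => ?_
  have h1 : f (μ * (x - t)) * z (σ t) - f (ν * (x - t)) * w (σ t) =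
      f (μ * (x - t)) * (z (σ t) - w (σ t)) +
        (f (μ * (x - t)) - f (ν * (x - t))) * w (σ t) := by ring
  rw [h1]
  refine (abs_add_le _ _).trans (add_le_add ?_ ?_)
  · rw [abs_mul]
    exact (mul_le_of_le_one_left (abs_nonneg _) (hf1 _)).trans (hS _ (hmap t))
  · rw [abs_mul]
    have h2 : |f (μ * (x - t)) - f (ν * (x - t))| ≤ |μ - ν| * Real.pi := by
      refine (hfL _ _).trans ?_
      rw [← sub_mul, abs_mul]
      refine mul_le_mul_of_nonneg_left (abs_le.mpr ⟨?_, ?_⟩) (abs_nonneg _)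
      · linarith [ht.2, hx.1]
      · linarith [ht.1, hx.2]
    calc _ ≤ (|μ - ν| * Real.pi) * 4 :=
          mul_le_mul h2 (hw4 _ (hmap t)) (abs_nonneg _) (by positivity)
      _ = _ := by ring

theorem abs_one_div_sub_one_div_le (hμ : 1 ≤ μ) (hν : 1 ≤ ν) : |1 / μ - 1 / ν| ≤ |μ - ν| / μ := by
  have h0 : 0 < μ := by linarith
  have h1 : 0 < ν := by linarith
  have h : 1 / μ - 1 / ν = (ν - μ) / μ / ν := by
    field_simp
  rw [h, abs_div, abs_div, abs_of_pos h0, abs_of_pos h1, abs_sub_comm]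
  exact div_le_self (by positivity) hν

theorem IsVolterraSolution.abs_sub_le (hz : IsVolterraSolution Q σ μ 1 z)
    (hw : IsVolterraSolution Q σ ν 1 w) (hQ : Integrable Q) (hσ : Measurable σ)
    (hmap : ∀ t, σ t ∈ Icc (0 : ℝ) Real.pi) (hμ : 1 ≤ μ) (hμQ : 2 * (∫ t, |Q t|) ≤ μ)
    (hν : 1 ≤ ν) (hνQ : 2 * (∫ t, |Q t|) ≤ ν) :
    ∀ x ∈ Icc (0 : ℝ) Real.pi, |z x - w x| ≤ 30 * |μ - ν| := by
  have hμ0 : 0 < μ := by linarith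
  have hw4 := hw.abs_apply_le hQ hmap (by linarith) hνQ
  have hpi := Real.pi_lt_d2
  -- Budget: 2 · 3.15 from the free terms, 2 · 3.15 from the kernel and 2 from the factor 1/μ, in
  -- total 14.6 ≤ 15. The rest is S/2.
  have h := abs_le_of_forall_abs_le_add_half (a := 15 * |μ - ν|)
    (hz.continuousOn.sub hw.continuousOn) fun S hS0 hS x hx => ?_
  · intro x hx
    have := h x hx
    rw [Pi.sub_apply] at this
    linarith
  have hker := abs_integral_kernel_sub_le (μ := μ) (ν := ν) hQ hmap Real.measurable_sin
    Real.abs_sin_le_one Real.abs_sin_sub_sin_le (hz.integrable hQ hσ hmap) (hw.integrable hQ hσ hmap)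
    hw4 hS0 hS hx
  have hker2 : |∫ τ in (0 : ℝ)..x, Q τ * (Real.sin (ν * (x - τ)) * w (σ τ))| ≤
      (∫ t, |Q t|) * 4 :=
    abs_intervalIntegral_mul_le hQ (by norm_num) (abs_sin_mul_le _ fun t => hw4 _ (hmap t))
  simp only [Pi.sub_apply]
  rw [hz.eq x hx, hw.eq x hx, one_mul, one_mul]
  set I := ∫ τ in (0 : ℝ)..x, Q τ * (Real.sin (μ * (x - τ)) * z (σ τ))
  set J := ∫ τ in (0 : ℝ)..x, Q τ * (Real.sin (ν * (x - τ)) * w (σ τ))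
  set κ := ∫ t, |Q t|
  have hx' : |μ * x - ν * x| ≤ 3.15 * |μ - ν| := by
    rw [← sub_mul, abs_mul, abs_of_nonneg hx.1, mul_comm]
    exact mul_le_mul_of_nonneg_right (by linarith [hx.2]) (abs_nonneg _)
  have e1 := (Real.abs_cos_sub_cos_le (μ * x) (ν * x)).trans hx'
  have e2 := (Real.abs_sin_sub_sin_le (μ * x) (ν * x)).trans hx'
  have e3 : |1 / μ * (I - J)| ≤ S / 2 + 2 * 3.15 * |μ - ν| := by
    rw [abs_mul, abs_of_pos (one_div_pos.mpr hμ0), one_div_mul_eq_div, div_le_iff₀ hμ0]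
    calc |I - J| ≤ κ * (S + 4 * Real.pi * |μ - ν|) := hker
      _ ≤ μ / 2 * (S + 4 * 3.15 * |μ - ν|) := by gcongr; linarith
      _ = _ := by ring
  have e4 : |(1 / μ - 1 / ν) * J| ≤ 2 * |μ - ν| := by
    rw [abs_mul]
    calc _ ≤ |μ - ν| / μ * (κ * 4) := by
          exact mul_le_mul (abs_one_div_sub_one_div_le hμ hν) hker2 (abs_nonneg _) (by positivity)
      _ = (4 * κ / μ) * |μ - ν| := by ring
      _ ≤ 2 * |μ - ν| := by
          gcongr
          rw [div_le_iff₀ hμ0]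
          linarith
  have hsplit : Real.cos (μ * x) - Real.sin (μ * x) - 1 / μ * I -
      (Real.cos (ν * x) - Real.sin (ν * x) - 1 / ν * J) =
      (Real.cos (μ * x) - Real.cos (ν * x)) - (Real.sin (μ * x) - Real.sin (ν * x)) -
        1 / μ * (I - J) - (1 / μ - 1 / ν) * J := by ring
  rw [hsplit]
  have a1 := abs_sub (Real.cos (μ * x) - Real.cos (ν * x)) (Real.sin (μ * x) - Real.sin (ν * x))
  have a2 := abs_sub ((Real.cos (μ * x) - Real.cos (ν * x)) -
    (Real.sin (μ * x) - Real.sin (ν * x))) (1 / μ * (I - J))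
  have a3 := abs_sub ((Real.cos (μ * x) - Real.cos (ν * x)) -
    (Real.sin (μ * x) - Real.sin (ν * x)) - 1 / μ * (I - J)) ((1 / μ - 1 / ν) * J)
  linarith [abs_nonneg (μ - ν)]

/-- The function `E` such that `cos μπ - sin μπ - E / μ` is the characteristic function
`z π + z' π / μ²` of the solution `z`. -/
noncomputable def charRemainder (Q σ : ℝ → ℝ) (μ : ℝ) (z : ℝ → ℝ) : ℝ :=
  (∫ τ in (0 : ℝ)..Real.pi, Q τ * (Real.sin (μ * (Real.pi - τ)) * z (σ τ))) +
    (Real.sin (μ * Real.pi) + Real.cos (μ * Real.pi)) +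
    1 / μ * ∫ τ in (0 : ℝ)..Real.pi, Q τ * (Real.cos (μ * (Real.pi - τ)) * z (σ τ))

theorem IsVolterraSolution.abs_charRemainder_le (hz : IsVolterraSolution Q σ μ 1 z)
    (hQ : Integrable Q) (hmap : ∀ t, σ t ∈ Icc (0 : ℝ) Real.pi) (hμ : 1 ≤ μ)
    (hμQ : 2 * (∫ t, |Q t|) ≤ μ) :
    |charRemainder Q σ μ z| ≤ 8 * (∫ t, |Q t|) + 2 := by
  have hμ0 : 0 < μ := by linarith
  have hz4 := hz.abs_apply_le hQ hmap hμ0 hμQ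
  have h1 : |∫ τ in (0 : ℝ)..Real.pi, Q τ * (Real.sin (μ * (Real.pi - τ)) * z (σ τ))| ≤
      (∫ t, |Q t|) * 4 :=
    abs_intervalIntegral_mul_le hQ (by norm_num) (abs_sin_mul_le _ fun t => hz4 _ (hmap t))
  have h2 : |∫ τ in (0 : ℝ)..Real.pi, Q τ * (Real.cos (μ * (Real.pi - τ)) * z (σ τ))| ≤
      (∫ t, |Q t|) * 4 :=
    abs_intervalIntegral_mul_le hQ (by norm_num) (abs_cos_mul_le _ fun t => hz4 _ (hmap t))
  have h3 := Real.abs_sin_le_one (μ * Real.pi)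
  have h4 := Real.abs_cos_le_one (μ * Real.pi)
  unfold charRemainder
  have h5 : |1 / μ * ∫ τ in (0 : ℝ)..Real.pi, Q τ * (Real.cos (μ * (Real.pi - τ)) * z (σ τ))| ≤
      (∫ t, |Q t|) * 4 := by
    rw [abs_mul, abs_of_pos (one_div_pos.mpr hμ0), one_div_mul_eq_div]
    exact (div_le_self (abs_nonneg _) hμ).trans h2
  rw [abs_le] at *
  constructor <;> linarith

theorem IsVolterraSolution.abs_charRemainder_sub_le (hz : IsVolterraSolution Q σ μ 1 z)
    (hw : IsVolterraSolution Q σ ν 1 w) (hQ : Integrable Q) (hσ : Measurable σ)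
    (hmap : ∀ t, σ t ∈ Icc (0 : ℝ) Real.pi) (hμ : 1 ≤ μ) (hμQ : 2 * (∫ t, |Q t|) ≤ μ)
    (hν : 1 ≤ ν) (hνQ : 2 * (∫ t, |Q t|) ≤ ν) :
    |charRemainder Q σ μ z - charRemainder Q σ ν w| ≤ (100 * (∫ t, |Q t|) + 10) * |μ - ν| := by
  have hμ0 : 0 < μ := by linarith
  have hw4 := hw.abs_apply_le hQ hmap (by linarith) hνQ
  have hS := hz.abs_sub_le hw hQ hσ hmap hμ hμQ hν hνQ
  have hpi := Real.pi_lt_d2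
  have hpm : Real.pi ∈ Icc (0 : ℝ) Real.pi := ⟨Real.pi_pos.le, le_rfl⟩
  have hκ : 0 ≤ ∫ t, |Q t| := integral_nonneg fun t => abs_nonneg _
  have hs := abs_integral_kernel_sub_le (μ := μ) (ν := ν) hQ hmap Real.measurable_sin
    Real.abs_sin_le_one Real.abs_sin_sub_sin_le (hz.integrable hQ hσ hmap) (hw.integrable hQ hσ hmap)
    hw4 (by positivity) hS hpm
  have hc := abs_integral_kernel_sub_le (μ := μ) (ν := ν) hQ hmap Real.measurable_cos
    Real.abs_cos_le_one Real.abs_cos_sub_cos_le (hz.integrable hQ hσ hmap) (hw.integrable hQ hσ hmap)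
    hw4 (by positivity) hS hpm
  have hc4 : |∫ τ in (0 : ℝ)..Real.pi, Q τ * (Real.cos (ν * (Real.pi - τ)) * w (σ τ))| ≤
      (∫ t, |Q t|) * 4 :=
    abs_intervalIntegral_mul_le hQ (by norm_num) (abs_cos_mul_le _ fun t => hw4 _ (hmap t))
  unfold charRemainder
  set I := ∫ τ in (0 : ℝ)..Real.pi, Q τ * (Real.sin (μ * (Real.pi - τ)) * z (σ τ))
  set J := ∫ τ in (0 : ℝ)..Real.pi, Q τ * (Real.sin (ν * (Real.pi - τ)) * w (σ τ))
  set I' := ∫ τ in (0 : ℝ)..Real.pi, Q τ * (Real.cos (μ * (Real.pi - τ)) * z (σ τ))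
  set J' := ∫ τ in (0 : ℝ)..Real.pi, Q τ * (Real.cos (ν * (Real.pi - τ)) * w (σ τ))
  set κ := ∫ t, |Q t|
  have hd := abs_nonneg (μ - ν)
  have hκd : 0 ≤ κ * |μ - ν| := by positivity
  have hx' : |μ * Real.pi - ν * Real.pi| ≤ 3.15 * |μ - ν| := by
    rw [← sub_mul, abs_mul, abs_of_nonneg Real.pi_pos.le, mul_comm]
    exact mul_le_mul_of_nonneg_right hpi.le (abs_nonneg _)
  -- 30 + 4π < 43. The terms with κ then add up to 43 + 43 + 4 ≤ 100, the free ones to 6.3 ≤ 10.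
  have hL : κ * (30 * |μ - ν| + 4 * Real.pi * |μ - ν|) ≤ 43 * (κ * |μ - ν|) := by
    nlinarith
  have e1 := (Real.abs_cos_sub_cos_le (μ * Real.pi) (ν * Real.pi)).trans hx'
  have e2 := (Real.abs_sin_sub_sin_le (μ * Real.pi) (ν * Real.pi)).trans hx'
  have e3 : |1 / μ * (I' - J')| ≤ 43 * (κ * |μ - ν|) := by
    rw [abs_mul, abs_of_pos (one_div_pos.mpr hμ0), one_div_mul_eq_div]
    exact (div_le_self (abs_nonneg _) hμ).trans (hc.trans hL)
  have e4 : |(1 / μ - 1 / ν) * J'| ≤ 4 * (κ * |μ - ν|) := by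
    rw [abs_mul]
    calc _ ≤ |μ - ν| * (κ * 4) := by
          exact mul_le_mul ((abs_one_div_sub_one_div_le hμ hν).trans (div_le_self hd hμ)) hc4
            (abs_nonneg _) hd
      _ = _ := by ring
  have e5 := hs.trans hL
  have hsplit : I + (Real.sin (μ * Real.pi) + Real.cos (μ * Real.pi)) + 1 / μ * I' -
      (J + (Real.sin (ν * Real.pi) + Real.cos (ν * Real.pi)) + 1 / ν * J') =
      (I - J) + (Real.sin (μ * Real.pi) - Real.sin (ν * Real.pi)) +
        (Real.cos (μ * Real.pi) - Real.cos (ν * Real.pi)) +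
        1 / μ * (I' - J') + (1 / μ - 1 / ν) * J' := by ring
  rw [hsplit]
  rw [abs_le] at e1 e2 e3 e4 e5 ⊢
  constructor <;> linarith

end VolterraLipschitz

/-! ### Equivalence of the differential and the integral equation. -/

section Characteristic

open MeasureTheory

/-- Rotating the vector (z, z'/μ) by the angle μx removes the free oscillation: its components then
have derivatives Q z(σ) sin(μx)/μ and -Q z(σ) cos(μx)/μ. Integrating and rotating back gives both
formulas. The countable set `s` leaves room for the nodes. -/
theorem IsVolterraSolution.of_hasDerivAt {Q σ : ℝ → ℝ} {μ : ℝ} {z z' : ℝ → ℝ} {s : Set ℝ}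
    (hμ : μ ≠ 0) (hs : s.Countable) (hz : ContinuousOn z (Icc 0 Real.pi))
    (hz' : ContinuousOn z' (Icc 0 Real.pi))
    (hd : ∀ x ∈ Ioo 0 Real.pi \ s, HasDerivAt z (z' x) x)
    (hd' : ∀ x ∈ Ioo 0 Real.pi \ s, HasDerivAt z' (-(Q x * z (σ x)) - μ ^ 2 * z x) x)
    (hg : Integrable fun τ => Q τ * z (σ τ)) (h0 : μ * z 0 + z' 0 = 0) :
    IsVolterraSolution Q σ μ (z 0) z ∧ ∀ x ∈ Icc (0 : ℝ) Real.pi,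
      z' x = -(μ * z 0 * (Real.sin (μ * x) + Real.cos (μ * x))) -
        ∫ τ in (0 : ℝ)..x, Q τ * (Real.cos (μ * (x - τ)) * z (σ τ)) := by
  have hz0 : z' 0 = -(μ * z 0) := by linarith
  have hgc : Integrable fun τ => Q τ * z (σ τ) * Real.cos (μ * τ) :=
    integrable_mul_of_abs_le hg (by fun_prop) fun t => Real.abs_cos_le_one _
  have hgs : Integrable fun τ => Q τ * z (σ τ) * Real.sin (μ * τ) :=
    integrable_mul_of_abs_le hg (by fun_prop) fun t => Real.abs_sin_le_one _
  have hcos : ∀ x, HasDerivAt (fun t => Real.cos (μ * t)) (-Real.sin (μ * x) * μ) x := fun x => by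
    simpa using ((hasDerivAt_id x).const_mul μ).cos
  have hsin : ∀ x, HasDerivAt (fun t => Real.sin (μ * t)) (Real.cos (μ * x) * μ) x := fun x => by
    simpa using ((hasDerivAt_id x).const_mul μ).sin
  have key : ∀ x ∈ Icc (0 : ℝ) Real.pi,
      (z x * Real.cos (μ * x) - z' x / μ * Real.sin (μ * x) =
        z 0 + 1 / μ * ∫ τ in (0 : ℝ)..x, Q τ * z (σ τ) * Real.sin (μ * τ)) ∧
      (z x * Real.sin (μ * x) + z' x / μ * Real.cos (μ * x) =
        -z 0 - 1 / μ * ∫ τ in (0 : ℝ)..x, Q τ * z (σ τ) * Real.cos (μ * τ)) := by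
    intro x hx
    have hsub : uIcc 0 x ⊆ Icc 0 Real.pi := by
      rw [uIcc_of_le hx.1]
      exact Icc_subset_Icc_right hx.2
    have hsub' : ∀ t ∈ Ioo (min 0 x) (max 0 x) \ s, t ∈ Ioo 0 Real.pi \ s := by
      rw [min_eq_left hx.1, max_eq_right hx.1]
      exact fun t ht => ⟨⟨ht.1.1, ht.1.2.trans_le hx.2⟩, ht.2⟩
    constructor
    · have h := MeasureTheory.integral_eq_of_hasDerivAt_off_countable (a := 0) (b := x)
        (fun t => z t * Real.cos (μ * t) - z' t / μ * Real.sin (μ * t))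
        (fun t => 1 / μ * (Q t * z (σ t) * Real.sin (μ * t))) hs
        (((hz.mono hsub).mul (by fun_prop)).sub
          (((hz'.mono hsub).div_const μ).mul (by fun_prop)))
        (fun t ht => by
          have h1 := (hd t (hsub' t ht)).mul (hcos t)
          have h2 := ((hd' t (hsub' t ht)).div_const μ).mul (hsin t)
          refine (h1.sub h2).congr_deriv ?_
          field_simp
          ring)
        (hgs.const_mul _).intervalIntegrable
      rw [intervalIntegral.integral_const_mul] at h
      simp only [mul_zero, Real.cos_zero, Real.sin_zero, mul_one, sub_zero] at h
      linarith
    · have h := MeasureTheory.integral_eq_of_hasDerivAt_off_countable (a := 0) (b := x)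
        (fun t => z t * Real.sin (μ * t) + z' t / μ * Real.cos (μ * t))
        (fun t => -(1 / μ) * (Q t * z (σ t) * Real.cos (μ * t))) hs
        (((hz.mono hsub).mul (by fun_prop)).add
          (((hz'.mono hsub).div_const μ).mul (by fun_prop)))
        (fun t ht => by
          have h1 := (hd t (hsub' t ht)).mul (hsin t)
          have h2 := ((hd' t (hsub' t ht)).div_const μ).mul (hcos t)
          refine (h1.add h2).congr_deriv ?_
          field_simp
          ring)
        (hgc.const_mul _).intervalIntegrable
      rw [intervalIntegral.integral_const_mul] at h
      simp only [mul_zero, Real.cos_zero, Real.sin_zero, mul_one, zero_add, hz0] at h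
      have h3 : -(μ * z 0) / μ = -z 0 := by field_simp
      rw [h3] at h
      linarith
  have hks : ∀ x, ∫ τ in (0 : ℝ)..x, Q τ * (Real.sin (μ * (x - τ)) * z (σ τ)) =
      ∫ τ in (0 : ℝ)..x, Q τ * z (σ τ) * Real.sin (μ * (x - τ)) := fun x => by
    congr 1
    funext τ
    ring
  have hkc : ∀ x, ∫ τ in (0 : ℝ)..x, Q τ * (Real.cos (μ * (x - τ)) * z (σ τ)) =
      ∫ τ in (0 : ℝ)..x, Q τ * z (σ τ) * Real.cos (μ * (x - τ)) := fun x => by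
    congr 1
    funext τ
    ring
  refine ⟨⟨hz, fun x hx => ?_⟩, fun x hx => ?_⟩
  · obtain ⟨h1, h2⟩ := key x hx
    rw [hks, integral_mul_sin_sub hg]
    linear_combination Real.cos (μ * x) * h1 + Real.sin (μ * x) * h2 -
      z x * Real.sin_sq_add_cos_sq (μ * x)
  · obtain ⟨h1, h2⟩ := key x hx
    rw [hkc, integral_mul_cos_sub hg]
    have h3 : z' x = μ * (z' x / μ) := by field_simp
    have h4 : μ * (1 / μ) = 1 := by field_simp
    linear_combination (-μ * Real.sin (μ * x)) * h1 + μ * Real.cos (μ * x) * h2 -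
      z' x / μ * μ * Real.sin_sq_add_cos_sq (μ * x) + h3 -
      (Real.sin (μ * x) * (∫ τ in (0 : ℝ)..x, Q τ * z (σ τ) * Real.sin (μ * τ)) +
      Real.cos (μ * x) * (∫ τ in (0 : ℝ)..x, Q τ * z (σ τ) * Real.cos (μ * τ))) * h4

/-- A solution of the Volterra equation extends to a continuously differentiable function on the
line which satisfies the differential equation where `Q` and `σ` are continuous. -/
theorem IsVolterraSolution.exists_differentiable {Q σ : ℝ → ℝ} {μ : ℝ} {z : ℝ → ℝ}
    (hz : IsVolterraSolution Q σ μ 1 z) (hQ : Integrable Q)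
    (hσ : Measurable σ) (hmap : ∀ t, σ t ∈ Icc (0 : ℝ) Real.pi) (hμ : μ ≠ 0) :
    ∃ Z Z' : ℝ → ℝ, Continuous Z ∧ Continuous Z' ∧ Z 0 = 1 ∧ Z' 0 = -μ ∧
      μ ^ 2 * Z Real.pi + Z' Real.pi = μ ^ 2 * (Real.cos (μ * Real.pi) -
        Real.sin (μ * Real.pi) - charRemainder Q σ μ z / μ) ∧
      ∀ x ∈ Icc (0 : ℝ) Real.pi, ContinuousWithinAt Q (Icc 0 Real.pi) x →
        ContinuousWithinAt σ (Icc 0 Real.pi) x →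
        HasDerivWithinAt Z (Z' x) (Icc 0 Real.pi) x ∧
        HasDerivWithinAt Z' (-(Q x * Z (σ x)) - μ ^ 2 * Z x) (Icc 0 Real.pi) x := by
  have hg := hz.integrable hQ hσ hmap
  have hgc : Integrable fun τ => Q τ * z (σ τ) * Real.cos (μ * τ) :=
    integrable_mul_of_abs_le hg (by fun_prop) fun t => Real.abs_cos_le_one _
  have hgs : Integrable fun τ => Q τ * z (σ τ) * Real.sin (μ * τ) :=
    integrable_mul_of_abs_le hg (by fun_prop) fun t => Real.abs_sin_le_one _
  have hcos : ∀ x, HasDerivAt (fun t => Real.cos (μ * t)) (-Real.sin (μ * x) * μ) x := fun x => by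
    simpa using ((hasDerivAt_id x).const_mul μ).cos
  have hsin : ∀ x, HasDerivAt (fun t => Real.sin (μ * t)) (Real.cos (μ * x) * μ) x := fun x => by
    simpa using ((hasDerivAt_id x).const_mul μ).sin
  have hks : ∀ x, ∫ τ in (0 : ℝ)..x, Q τ * (Real.sin (μ * (x - τ)) * z (σ τ)) =
      ∫ τ in (0 : ℝ)..x, Q τ * z (σ τ) * Real.sin (μ * (x - τ)) := fun x => by
    congr 1
    funext τ
    ring
  have hkc : ∀ x, ∫ τ in (0 : ℝ)..x, Q τ * (Real.cos (μ * (x - τ)) * z (σ τ)) =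
      ∫ τ in (0 : ℝ)..x, Q τ * z (σ τ) * Real.cos (μ * (x - τ)) := fun x => by
    congr 1
    funext τ
    ring
  obtain ⟨A, hA⟩ : ∃ A : ℝ → ℝ, A = fun x => ∫ τ in (0 : ℝ)..x,
    Q τ * z (σ τ) * Real.cos (μ * τ) := ⟨_, rfl⟩
  obtain ⟨B, hB⟩ : ∃ B : ℝ → ℝ, B = fun x => ∫ τ in (0 : ℝ)..x,
    Q τ * z (σ τ) * Real.sin (μ * τ) := ⟨_, rfl⟩
  have hAc : Continuous A := by
    rw [hA]
    exact intervalIntegral.continuous_primitive (fun a b => hgc.intervalIntegrable) 0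
  have hBc : Continuous B := by
    rw [hB]
    exact intervalIntegral.continuous_primitive (fun a b => hgs.intervalIntegrable) 0
  obtain ⟨Z, hZ⟩ : ∃ Z : ℝ → ℝ, Z = fun x => Real.cos (μ * x) - Real.sin (μ * x) -
    1 / μ * (Real.sin (μ * x) * A x - Real.cos (μ * x) * B x) := ⟨_, rfl⟩
  obtain ⟨Z', hZ'⟩ : ∃ Z' : ℝ → ℝ, Z' = fun x => -(μ * (Real.sin (μ * x) + Real.cos (μ * x))) -
    (Real.cos (μ * x) * A x + Real.sin (μ * x) * B x) := ⟨_, rfl⟩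
  have hZc : Continuous Z := by
    rw [hZ]
    fun_prop
  have hZz : ∀ x ∈ Icc (0 : ℝ) Real.pi, z x = Z x := fun x hx => by
    rw [hz.eq x hx, hks, integral_mul_sin_sub hg, hZ, hA, hB, one_mul]
  have hA0 : A 0 = 0 := by simp [hA]
  have hB0 : B 0 = 0 := by simp [hB]
  refine ⟨Z, Z', hZc, ?_, ?_, ?_, ?_, fun x hx hQx hσx => ?_⟩
  · rw [hZ']
    fun_prop
  · simp [hZ, hA0, hB0]
  · simp [hZ', hA0, hB0]
  · unfold charRemainder
    rw [hks, hkc, integral_mul_sin_sub hg, integral_mul_cos_sub hg, hZ, hZ', hA, hB]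
    field_simp
    ring
  -- This instance selects the fundamental theorem of calculus relative to [0, π], which covers the
  -- endpoints too.
  · have : Fact (x ∈ Icc (0 : ℝ) Real.pi) := ⟨hx⟩
    have hgZ : (fun τ => Q τ * z (σ τ)) = fun τ => Q τ * Z (σ τ) :=
      funext fun τ => by rw [hZz _ (hmap τ)]
    have hgx : ContinuousWithinAt (fun τ => Q τ * z (σ τ)) (Icc 0 Real.pi) x := by
      rw [hgZ]
      exact hQx.mul (hZc.continuousAt.comp_continuousWithinAt hσx)
    have hAd : HasDerivWithinAt A (Q x * z (σ x) * Real.cos (μ * x)) (Icc 0 Real.pi) x := by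
      rw [hA]
      exact intervalIntegral.integral_hasDerivWithinAt_right hgc.intervalIntegrable
        hgc.aestronglyMeasurable.stronglyMeasurableAtFilter
        (hgx.mul (by fun_prop))
    have hBd : HasDerivWithinAt B (Q x * z (σ x) * Real.sin (μ * x)) (Icc 0 Real.pi) x := by
      rw [hB]
      exact intervalIntegral.integral_hasDerivWithinAt_right hgs.intervalIntegrable
        hgs.aestronglyMeasurable.stronglyMeasurableAtFilter
        (hgx.mul (by fun_prop))
    have hc := (hcos x).hasDerivWithinAt (s := Icc 0 Real.pi)
    have hs := (hsin x).hasDerivWithinAt (s := Icc 0 Real.pi)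
    constructor
    · rw [hZ, hZ']
      refine ((hc.sub hs).sub (((hs.mul hAd).sub (hc.mul hBd)).const_mul (1 / μ))).congr_deriv ?_
      field_simp
      ring
    · rw [← hZz _ (hmap x)]
      rw [hZ, hZ']
      refine ((((hs.add hc).const_mul μ).neg).sub
        ((hc.mul hAd).add (hs.mul hBd))).congr_deriv ?_
      have h4 : μ * (1 / μ) = 1 := by field_simp
      linear_combination (-(Q x * z (σ x))) * Real.sin_sq_add_cos_sq (μ * x) -
        μ * (Real.sin (μ * x) * A x - Real.cos (μ * x) * B x) * h4

end Characteristic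

/-! ### Removing the transmission conditions by scaling. -/

namespace RetardedProblem

open MeasureTheory

variable (P : RetardedProblem)

theorem mem_domain_iff {x : ℝ} :
    x ∈ P.domain ↔ x ∈ Icc (0 : ℝ) Real.pi ∧ x ≠ P.h₁ ∧ x ≠ P.h₂ := by
  have h1 := P.h₁_pos
  have h2 := P.h₁_lt_h₂
  have h3 := P.h₂_lt_pi
  simp only [domain, pieces, mem_union, mem_Ico, mem_Ioo, mem_Ioc, mem_Icc]
  constructor
  · rintro ((⟨h, h'⟩ | ⟨h, h'⟩) | ⟨h, h'⟩)
    · exact ⟨⟨h, by linarith⟩, by linarith, by linarith⟩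
    · exact ⟨⟨by linarith, by linarith⟩, h.ne', h'.ne⟩
    · exact ⟨⟨by linarith, h'⟩, by linarith, h.ne'⟩
  · rintro ⟨⟨h, h'⟩, h4, h5⟩
    rcases lt_or_gt_of_ne h4 with h6 | h6
    · exact Or.inl (Or.inl ⟨h, h6⟩)
    · rcases lt_or_gt_of_ne h5 with h7 | h7
      · exact Or.inl (Or.inr ⟨h6, h7⟩)
      · exact Or.inr ⟨h7, h'⟩

theorem domain_eq : P.domain = Icc (0 : ℝ) Real.pi \ {P.h₁, P.h₂} := by
  ext x
  simp [P.mem_domain_iff]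

theorem domain_subset : P.domain ⊆ Icc (0 : ℝ) Real.pi := fun _ hx => (P.mem_domain_iff.mp hx).1

theorem measurableSet_domain : MeasurableSet P.domain :=
  (measurableSet_Ico.union measurableSet_Ioo).union measurableSet_Ioc

theorem compl_nodes_mem_nhds {x : ℝ} (hx : x ∈ P.domain) : ({P.h₁, P.h₂} : Set ℝ)ᶜ ∈ 𝓝 x := by
  have h : IsOpen ({P.h₁, P.h₂} : Set ℝ)ᶜ := (Set.toFinite _).isClosed.isOpen_compl
  refine h.mem_nhds ?_
  have := P.mem_domain_iff.mp hx
  simp [this.2.1, this.2.2]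

/-- The domain is [0, π] without two points, which form a closed set, so limits at a point of the
domain may be taken within either set. -/
theorem nhdsWithin_domain {x : ℝ} (hx : x ∈ P.domain) :
    𝓝[P.domain] x = 𝓝[Icc 0 Real.pi] x := by
  rw [P.domain_eq, sdiff_eq]
  exact nhdsWithin_inter_of_mem' (mem_nhdsWithin_of_mem_nhds (P.compl_nodes_mem_nhds hx))

theorem domain_mem_nhds {x : ℝ} (hx : x ∈ Ioo 0 Real.pi \ {P.h₁, P.h₂}) : P.domain ∈ 𝓝 x := by
  have hd : x ∈ P.domain := by
    rw [P.domain_eq]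
    exact ⟨Ioo_subset_Icc_self hx.1, hx.2⟩
  rw [P.domain_eq, sdiff_eq]
  exact inter_mem (Icc_mem_nhds hx.1.1 hx.1.2) (P.compl_nodes_mem_nhds hd)

/-- The potential, extended by zero. -/
noncomputable def potential : ℝ → ℝ := P.domain.indicator P.q

/-- The retarded argument `x - Δ x`, extended by zero. -/
noncomputable def argument : ℝ → ℝ := P.domain.indicator fun x => x - P.Δ x

theorem potential_of_mem {x : ℝ} (hx : x ∈ P.domain) : P.potential x = P.q x :=
  indicator_of_mem hx _

theorem argument_of_mem {x : ℝ} (hx : x ∈ P.domain) : P.argument x = x - P.Δ x :=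
  indicator_of_mem hx _

theorem measurable_argument : Measurable P.argument := by
  classical
  have h : P.argument = P.domain.piecewise (fun x => x - P.Δ x) (fun _ => 0) := by
    exact piecewise_eq_indicator.symm
  rw [h]
  exact (continuousOn_id.sub P.Δ_continuousOn).measurable_piecewise continuousOn_const
    P.measurableSet_domain

theorem argument_bounds {x : ℝ} (hx : x ∈ P.domain) :
    (x < P.h₁ → 0 ≤ P.argument x ∧ P.argument x < P.h₁) ∧
    (P.h₁ < x → x < P.h₂ → P.h₁ ≤ P.argument x ∧ P.argument x < P.h₂) ∧
    (P.h₂ < x → P.h₂ ≤ P.argument x ∧ P.argument x ≤ Real.pi) := by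
  have hD := P.Δ_nonneg x hx
  have hx' := (P.domain_subset hx)
  rw [P.argument_of_mem hx]
  refine ⟨fun h => ⟨P.delay₁ x ⟨hx'.1, h⟩, by linarith⟩,
    fun h h' => ⟨P.delay₂ x ⟨h, h'⟩, by linarith⟩, fun h => ⟨?_, by linarith [hx'.2]⟩⟩
  -- The delay condition on the last piece is assumed only for x < π; at π it follows by continuity.
  have hcont : ContinuousWithinAt (fun t => t - P.Δ t) (Ioo P.h₂ Real.pi) x :=
    continuousWithinAt_id.sub
      ((P.Δ_continuousOn x hx).mono fun t ht => Or.inr (Ioo_subset_Ioc_self ht))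
  have hne : (𝓝[Ioo P.h₂ Real.pi] x).NeBot := by
    rw [← mem_closure_iff_nhdsWithin_neBot, closure_Ioo P.h₂_lt_pi.ne]
    exact ⟨h.le, hx'.2⟩
  exact ge_of_tendsto hcont (eventually_nhdsWithin_of_forall P.delay₃)

theorem argument_mem (x : ℝ) : P.argument x ∈ Icc (0 : ℝ) Real.pi := by
  by_cases hx : x ∈ P.domain
  · have h1 := P.h₁_pos
    have h2 := P.h₁_lt_h₂
    have h3 := P.h₂_lt_pi
    have hb := P.argument_bounds hx
    have hm := P.mem_domain_iff.mp hx
    rcases lt_or_gt_of_ne hm.2.1 with h | h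
    · exact ⟨(hb.1 h).1, by linarith [(hb.1 h).2]⟩
    · rcases lt_or_gt_of_ne hm.2.2 with h' | h'
      · exact ⟨by linarith [(hb.2.1 h h').1], by linarith [(hb.2.1 h h').2]⟩
      · exact ⟨by linarith [(hb.2.2 h').1], (hb.2.2 h').2⟩
  · rw [argument, indicator_of_notMem hx]
    exact ⟨le_rfl, Real.pi_pos.le⟩

theorem continuousWithinAt_potential {x : ℝ} (hx : x ∈ P.domain) :
    ContinuousWithinAt P.potential (Icc 0 Real.pi) x := by
  rw [ContinuousWithinAt, ← P.nhdsWithin_domain hx]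
  exact (P.q_continuousOn x hx).congr (fun t ht => P.potential_of_mem ht) (P.potential_of_mem hx)

theorem continuousWithinAt_argument {x : ℝ} (hx : x ∈ P.domain) :
    ContinuousWithinAt P.argument (Icc 0 Real.pi) x := by
  rw [ContinuousWithinAt, ← P.nhdsWithin_domain hx]
  exact (continuousWithinAt_id.sub (P.Δ_continuousOn x hx)).congr
    (fun t ht => P.argument_of_mem ht) (P.argument_of_mem hx)

/-- The function with values `1`, `a`, `b` on the three pieces. -/
noncomputable def scale (a b x : ℝ) : ℝ := if x < P.h₁ then 1 else if x < P.h₂ then a else b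

variable {P} {a b : ℝ}

theorem scale_of_lt {x : ℝ} (h : x < P.h₁) : P.scale a b x = 1 := if_pos h

theorem scale_of_mem_Ico {x : ℝ} (h : P.h₁ ≤ x) (h' : x < P.h₂) : P.scale a b x = a := by
  rw [scale, if_neg h.not_gt, if_pos h']

theorem scale_of_ge {x : ℝ} (h : P.h₂ ≤ x) : P.scale a b x = b := by
  rw [scale, if_neg (P.h₁_lt_h₂.le.trans h).not_gt, if_neg h.not_gt]

/-- This lets the scaling pass through the delay. It also needs `scale` to take its right-hand
values at the nodes, because the retarded argument may equal a node approached from the right. -/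
theorem scale_argument {x : ℝ} (hx : x ∈ P.domain) :
    P.scale a b (P.argument x) = P.scale a b x := by
  have hb := P.argument_bounds hx
  have hm := P.mem_domain_iff.mp hx
  rcases lt_or_gt_of_ne hm.2.1 with h | h
  · rw [scale_of_lt h, scale_of_lt (hb.1 h).2]
  · rcases lt_or_gt_of_ne hm.2.2 with h' | h'
    · rw [scale_of_mem_Ico h.le h', scale_of_mem_Ico (hb.2.1 h h').1 (hb.2.1 h h').2]
    · rw [scale_of_ge h'.le, scale_of_ge (hb.2.2 h').1]

theorem scale_eventuallyEq {x : ℝ} (h1 : x ≠ P.h₁) (h2 : x ≠ P.h₂) :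
    ∀ᶠ t in 𝓝 x, P.scale a b t = P.scale a b x := by
  rcases lt_or_gt_of_ne h1 with h | h
  · filter_upwards [Iio_mem_nhds h] with t ht
    rw [scale_of_lt h, scale_of_lt ht]
  · rcases lt_or_gt_of_ne h2 with h' | h'
    · filter_upwards [Ioo_mem_nhds h h'] with t ht
      rw [scale_of_mem_Ico h.le h', scale_of_mem_Ico ht.1.le ht.2]
    · filter_upwards [Ioi_mem_nhds h'] with t ht
      rw [scale_of_ge h'.le, scale_of_ge (le_of_lt ht)]

theorem scale_left₁ : ∀ᶠ t in 𝓝[<] P.h₁, P.scale a b t = 1 :=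
  eventually_nhdsWithin_of_forall fun _ ht => scale_of_lt ht

theorem scale_right₁ : ∀ᶠ t in 𝓝[>] P.h₁, P.scale a b t = a := by
  filter_upwards [Ioo_mem_nhdsGT P.h₁_lt_h₂] with t ht using scale_of_mem_Ico ht.1.le ht.2

theorem scale_left₂ : ∀ᶠ t in 𝓝[<] P.h₂, P.scale a b t = a := by
  filter_upwards [Ioo_mem_nhdsLT P.h₁_lt_h₂] with t ht using scale_of_mem_Ico ht.1.le ht.2

theorem scale_right₂ : ∀ᶠ t in 𝓝[>] P.h₂, P.scale a b t = b :=
  eventually_nhdsWithin_of_forall fun _ ht => scale_of_ge (le_of_lt ht)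

theorem hasDerivWithinAt_scale_mul {f : ℝ → ℝ} {f' x : ℝ} {s : Set ℝ} (hx : x ∈ P.domain)
    (hf : HasDerivWithinAt f f' s x) :
    HasDerivWithinAt (fun t => P.scale a b t * f t) (P.scale a b x * f') s x := by
  have hm := P.mem_domain_iff.mp hx
  refine (hf.const_mul (P.scale a b x)).congr_of_eventuallyEq ?_ rfl
  filter_upwards [mem_nhdsWithin_of_mem_nhds (scale_eventuallyEq (a := a) (b := b) hm.2.1 hm.2.2)]
    with t ht
  rw [ht]

theorem continuousOn_scale_mul {f : ℝ → ℝ} (hf : ContinuousOn f P.domain)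
    (h₁ : Transmission f P.h₁ P.δ) (h₂ : Transmission f P.h₂ P.θ)
    (hr₁ : Tendsto f (𝓝[>] P.h₁) (𝓝 (f P.h₁))) (hr₂ : Tendsto f (𝓝[>] P.h₂) (𝓝 (f P.h₂))) :
    ContinuousOn (fun t => P.scale P.δ (P.δ * P.θ) t * f t) (Icc 0 Real.pi) := by
  intro x hx
  by_cases hx1 : x = P.h₁
  · subst hx1
    refine ContinuousAt.continuousWithinAt (continuousAt_iff_continuous_left'_right'.mpr ⟨?_, ?_⟩)
    · obtain ⟨l, r, hl, hr, hlr⟩ := h₁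
      have : r = f P.h₁ := tendsto_nhds_unique hr hr₁
      rw [ContinuousWithinAt, scale_of_mem_Ico le_rfl P.h₁_lt_h₂, ← this,
        ← sub_eq_zero.mp hlr]
      refine hl.congr' ?_
      filter_upwards [scale_left₁ (P := P) (a := P.δ) (b := P.δ * P.θ)] with t ht
      rw [ht, one_mul]
    · rw [ContinuousWithinAt, scale_of_mem_Ico le_rfl P.h₁_lt_h₂]
      refine (hr₁.const_mul P.δ).congr' ?_
      filter_upwards [scale_right₁ (P := P) (a := P.δ) (b := P.δ * P.θ)] with t ht
      rw [ht]
  by_cases hx2 : x = P.h₂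
  · subst hx2
    refine ContinuousAt.continuousWithinAt (continuousAt_iff_continuous_left'_right'.mpr ⟨?_, ?_⟩)
    · obtain ⟨l, r, hl, hr, hlr⟩ := h₂
      have : r = f P.h₂ := tendsto_nhds_unique hr hr₂
      rw [ContinuousWithinAt, scale_of_ge le_rfl, ← this, mul_assoc,
        ← sub_eq_zero.mp hlr]
      refine (hl.const_mul P.δ).congr' ?_
      filter_upwards [scale_left₂ (P := P) (a := P.δ) (b := P.δ * P.θ)] with t ht
      rw [ht]
    · rw [ContinuousWithinAt, scale_of_ge le_rfl]
      refine (hr₂.const_mul (P.δ * P.θ)).congr' ?_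
      filter_upwards [scale_right₂ (P := P) (a := P.δ) (b := P.δ * P.θ)] with t ht
      rw [ht]
  have hd : x ∈ P.domain := P.mem_domain_iff.mpr ⟨hx, hx1, hx2⟩
  have hc := hf x hd
  rw [ContinuousWithinAt, P.nhdsWithin_domain hd] at hc
  refine (hc.const_mul (P.scale P.δ (P.δ * P.θ) x)).congr' ?_
  filter_upwards [mem_nhdsWithin_of_mem_nhds (scale_eventuallyEq (a := P.δ) (b := P.δ * P.θ)
    hx1 hx2)] with t ht
  rw [ht]

theorem transmission_scale_mul₁ {Z : ℝ → ℝ} (hZ : Continuous Z) :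
    Transmission (fun t => P.scale P.δ⁻¹ (P.δ * P.θ)⁻¹ t * Z t) P.h₁ P.δ := by
  refine ⟨1 * Z P.h₁, P.δ⁻¹ * Z P.h₁, ?_, ?_, ?_⟩
  · refine ((hZ.tendsto _).mono_left nhdsWithin_le_nhds |>.const_mul 1).congr' ?_
    filter_upwards [scale_left₁ (P := P) (a := P.δ⁻¹) (b := (P.δ * P.θ)⁻¹)] with t ht
    rw [ht]
  · refine ((hZ.tendsto _).mono_left nhdsWithin_le_nhds |>.const_mul P.δ⁻¹).congr' ?_
    filter_upwards [scale_right₁ (P := P) (a := P.δ⁻¹) (b := (P.δ * P.θ)⁻¹)] with t ht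
    rw [ht]
  · have := P.δ_ne_zero
    field_simp
    ring

theorem transmission_scale_mul₂ {Z : ℝ → ℝ} (hZ : Continuous Z) :
    Transmission (fun t => P.scale P.δ⁻¹ (P.δ * P.θ)⁻¹ t * Z t) P.h₂ P.θ := by
  refine ⟨P.δ⁻¹ * Z P.h₂, (P.δ * P.θ)⁻¹ * Z P.h₂, ?_, ?_, ?_⟩
  · refine ((hZ.tendsto _).mono_left nhdsWithin_le_nhds |>.const_mul P.δ⁻¹).congr' ?_
    filter_upwards [scale_left₂ (P := P) (a := P.δ⁻¹) (b := (P.δ * P.θ)⁻¹)] with t ht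
    rw [ht]
  · refine ((hZ.tendsto _).mono_left nhdsWithin_le_nhds |>.const_mul (P.δ * P.θ)⁻¹).congr' ?_
    filter_upwards [scale_right₂ (P := P) (a := P.δ⁻¹) (b := (P.δ * P.θ)⁻¹)] with t ht
    rw [ht]
  · have := P.δ_ne_zero
    have := P.θ_ne_zero
    field_simp
    ring

/-- The eigenfunction is the differentiable solution divided by 1, δ, δθ on the pieces. -/
theorem isEigenvalue_of_charRemainder {μ : ℝ} {z : ℝ → ℝ} (hQ : Integrable P.potential)
    (hμ : 0 < μ) (hz : IsVolterraSolution P.potential P.argument μ 1 z)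
    (hchar : Real.cos (μ * Real.pi) - Real.sin (μ * Real.pi) -
      charRemainder P.potential P.argument μ z / μ = 0) : P.IsEigenvalue μ := by
  obtain ⟨Z, Z', hZ, hZ', hZ0, hZ'0, hZpi, hder⟩ :=
    hz.exists_differentiable hQ P.measurable_argument P.argument_mem hμ.ne'
  rw [hchar, mul_zero] at hZpi
  have hder' : ∀ x ∈ P.domain, _ := fun x hx => hder x (P.domain_subset hx)
    (P.continuousWithinAt_potential hx) (P.continuousWithinAt_argument hx)
  have h0 : (0 : ℝ) < P.h₁ := P.h₁_pos
  refine ⟨hμ, fun t => P.scale P.δ⁻¹ (P.δ * P.θ)⁻¹ t * Z t,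
    fun t => P.scale P.δ⁻¹ (P.δ * P.θ)⁻¹ t * Z' t,
    fun t => P.scale P.δ⁻¹ (P.δ * P.θ)⁻¹ t *
      (-(P.potential t * Z (P.argument t)) - μ ^ 2 * Z t),
    fun x hx => hasDerivWithinAt_scale_mul hx ((hder' x hx).1.mono P.domain_subset),
    fun x hx => hasDerivWithinAt_scale_mul hx ((hder' x hx).2.mono P.domain_subset),
    fun x hx => ?_, ?_, ?_, ?_, ?_, transmission_scale_mul₁ hZ, transmission_scale_mul₁ hZ',
    transmission_scale_mul₂ hZ, transmission_scale_mul₂ hZ', ?_⟩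
  · rw [← P.argument_of_mem hx, scale_argument hx, P.potential_of_mem hx]
    ring
  · rw [scale_of_mem_Ico le_rfl P.h₁_lt_h₂]
    refine ((hZ.tendsto _).mono_left nhdsWithin_le_nhds |>.const_mul P.δ⁻¹).congr' ?_
    filter_upwards [scale_right₁ (P := P) (a := P.δ⁻¹) (b := (P.δ * P.θ)⁻¹)] with t ht
    rw [ht]
  · rw [scale_of_ge le_rfl]
    refine ((hZ.tendsto _).mono_left nhdsWithin_le_nhds |>.const_mul (P.δ * P.θ)⁻¹).congr' ?_
    filter_upwards [scale_right₂ (P := P) (a := P.δ⁻¹) (b := (P.δ * P.θ)⁻¹)] with t ht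
    rw [ht]
  · rw [scale_of_lt h0, hZ0, hZ'0]
    ring
  · rw [scale_of_ge P.h₂_lt_pi.le]
    linear_combination (P.δ * P.θ)⁻¹ * hZpi
  · refine ⟨0, Or.inl (Or.inl ⟨le_rfl, h0⟩), ?_⟩
    rw [scale_of_lt h0, hZ0]
    norm_num

theorem IsEigenfunctionWith.exists_isVolterraSolution {μ : ℝ} {y y' y'' : ℝ → ℝ} (hμ : μ ≠ 0)
    (h : P.IsEigenfunctionWith μ y y' y'') (hQ : Integrable P.potential) :
    ∃ c z, IsVolterraSolution P.potential P.argument μ c z ∧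
      (∃ x ∈ Icc (0 : ℝ) Real.pi, z x ≠ 0) ∧
      μ ^ 2 * z Real.pi - μ * c * (Real.sin (μ * Real.pi) + Real.cos (μ * Real.pi)) -
        (∫ τ in (0 : ℝ)..Real.pi, P.potential τ *
          (Real.cos (μ * (Real.pi - τ)) * z (P.argument τ))) = 0 := by
  obtain ⟨l₁, r₁, hl₁, hr₁, hlr₁⟩ := h.transmission₁'
  obtain ⟨l₂, r₂, hl₂, hr₂, hlr₂⟩ := h.transmission₂'
  -- Nothing is known about `y'` at the nodes themselves. It is given its right-hand limits there,
  -- so that the scaled derivative is continuous.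
  obtain ⟨w, hw⟩ : ∃ w, w = Function.update (Function.update y' P.h₁ r₁) P.h₂ r₂ := ⟨_, rfl⟩
  have hwne : ∀ t, t ≠ P.h₁ → t ≠ P.h₂ → w t = y' t := fun t ht1 ht2 => by
    rw [hw, Function.update_of_ne ht2, Function.update_of_ne ht1]
  have hw1 : w P.h₁ = r₁ := by
    rw [hw, Function.update_of_ne P.h₁_lt_h₂.ne, Function.update_self]
  have hw2 : w P.h₂ = r₂ := by
    rw [hw, Function.update_self]
  have hw_left₁ : w =ᶠ[𝓝[<] P.h₁] y' := by
    filter_upwards [self_mem_nhdsWithin] with t ht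
    exact hwne t (ne_of_lt ht) (ne_of_lt (lt_trans ht P.h₁_lt_h₂))
  have hw_right₁ : w =ᶠ[𝓝[>] P.h₁] y' := by
    filter_upwards [Ioo_mem_nhdsGT P.h₁_lt_h₂] with t ht
    exact hwne t ht.1.ne' ht.2.ne
  have hw_left₂ : w =ᶠ[𝓝[<] P.h₂] y' := by
    filter_upwards [Ioo_mem_nhdsLT P.h₁_lt_h₂] with t ht
    exact hwne t ht.1.ne' ht.2.ne
  have hw_right₂ : w =ᶠ[𝓝[>] P.h₂] y' := by
    filter_upwards [self_mem_nhdsWithin] with t ht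
    exact hwne t (ne_of_gt (lt_trans P.h₁_lt_h₂ ht)) (ne_of_gt ht)
  have hwdom : ∀ t ∈ P.domain, w t = y' t := fun t ht =>
    hwne t (P.mem_domain_iff.mp ht).2.1 (P.mem_domain_iff.mp ht).2.2
  have hzc := continuousOn_scale_mul (fun x hx => (h.hasDeriv x hx).continuousWithinAt)
    h.transmission₁ h.transmission₂ h.right₁ h.right₂
  have hwc := continuousOn_scale_mul (f := w)
    (fun x hx => ((h.hasDeriv' x hx).continuousWithinAt).congr hwdom (hwdom x hx))
    ⟨l₁, r₁, hl₁.congr' hw_left₁.symm, hr₁.congr' hw_right₁.symm, hlr₁⟩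
    ⟨l₂, r₂, hl₂.congr' hw_left₂.symm, hr₂.congr' hw_right₂.symm, hlr₂⟩
    (hw1 ▸ hr₁.congr' hw_right₁.symm) (hw2 ▸ hr₂.congr' hw_right₂.symm)
  obtain ⟨z, hz⟩ : ∃ z, z = fun t => P.scale P.δ (P.δ * P.θ) t * y t := ⟨_, rfl⟩
  obtain ⟨z', hz'⟩ : ∃ z', z' = fun t => P.scale P.δ (P.δ * P.θ) t * w t := ⟨_, rfl⟩
  rw [← hz] at hzc
  rw [← hz'] at hwc
  have hdom : ∀ x ∈ Ioo 0 Real.pi \ {P.h₁, P.h₂}, x ∈ P.domain := fun x hx =>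
    mem_of_mem_nhds (P.domain_mem_nhds hx)
  have h0 : (0 : ℝ) ∈ P.domain := Or.inl (Or.inl ⟨le_rfl, P.h₁_pos⟩)
  have hpi : Real.pi ∈ P.domain := Or.inr ⟨P.h₂_lt_pi, le_rfl⟩
  have hg : Integrable fun τ => P.potential τ * z (P.argument τ) := by
    obtain ⟨C, hC⟩ := isCompact_Icc.exists_bound_of_continuousOn hzc
    exact integrable_mul_of_abs_le hQ
      (measurable_comp_of_continuousOn_Icc P.measurable_argument P.argument_mem hzc)
      fun t => hC _ (P.argument_mem t)
  obtain ⟨hV, hV'⟩ := IsVolterraSolution.of_hasDerivAt (σ := P.argument) (s := {P.h₁, P.h₂}) hμ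
    (Set.toFinite _).countable hzc hwc
    (fun x hx => by
      rw [hz, hz']
      simp only
      rw [hwdom x (hdom x hx)]
      exact (hasDerivWithinAt_scale_mul (hdom x hx) (h.hasDeriv x (hdom x hx))).hasDerivAt
        (P.domain_mem_nhds hx))
    (fun x hx => by
      have hd := hdom x hx
      have h1 : HasDerivWithinAt w (y'' x) P.domain x :=
        (h.hasDeriv' x hd).congr hwdom (hwdom x hd)
      rw [hz']
      refine ((hasDerivWithinAt_scale_mul hd h1).hasDerivAt (P.domain_mem_nhds hx)).congr_deriv ?_
      rw [hz]
      simp only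
      rw [scale_argument hd, P.argument_of_mem hd, P.potential_of_mem hd]
      linear_combination P.scale P.δ (P.δ * P.θ) x * h.equation x hd)
    hg
    (by
      rw [hz, hz']
      simp only
      rw [scale_of_lt P.h₁_pos, hwdom 0 h0]
      linear_combination h.boundary_zero)
  refine ⟨z 0, z, hV, ?_, ?_⟩
  · obtain ⟨x, hx, hyx⟩ := h.nontrivial
    refine ⟨x, P.domain_subset hx, ?_⟩
    rw [hz]
    refine mul_ne_zero ?_ hyx
    have h1 := P.δ_ne_zero
    have h2 := mul_ne_zero P.δ_ne_zero P.θ_ne_zero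
    unfold scale
    split_ifs
    · exact one_ne_zero
    · exact h1
    · exact h2
  · have h1 := hV' Real.pi (P.domain_subset hpi)
    have h2 : μ ^ 2 * z Real.pi + z' Real.pi = 0 := by
      rw [hz, hz']
      simp only
      rw [hwdom _ hpi]
      linear_combination P.scale P.δ (P.δ * P.θ) Real.pi * h.boundary_pi
    rw [h1] at h2
    linear_combination h2

/-- By uniqueness a scaled eigenfunction is c·w, and c ≠ 0 since it does not vanish identically;
dividing the condition at π by cμ² leaves the characteristic equation. -/
theorem isEigenvalue_iff {μ : ℝ} {w : ℝ → ℝ} (hQ : Integrable P.potential) (hμ : 0 < μ)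
    (hμQ : 2 * (∫ t, |P.potential t|) ≤ μ)
    (hw : IsVolterraSolution P.potential P.argument μ 1 w) :
    P.IsEigenvalue μ ↔ Real.cos (μ * Real.pi) - Real.sin (μ * Real.pi) -
      charRemainder P.potential P.argument μ w / μ = 0 := by
  refine ⟨fun ⟨_, y, y', y'', h⟩ => ?_, isEigenvalue_of_charRemainder hQ hμ hw⟩
  obtain ⟨c, z, hz, ⟨x, hx, hzx⟩, hchar⟩ := h.exists_isVolterraSolution hμ.ne' hQ
  have hzw := hz.eq_mul hw hQ P.measurable_argument P.argument_mem hμ hμQ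
  have hc : c ≠ 0 := by
    rintro rfl
    exact hzx (by rw [hzw x hx, zero_mul])
  have hI : ∫ τ in (0 : ℝ)..Real.pi, P.potential τ *
      (Real.cos (μ * (Real.pi - τ)) * z (P.argument τ)) =
      c * ∫ τ in (0 : ℝ)..Real.pi, P.potential τ *
      (Real.cos (μ * (Real.pi - τ)) * w (P.argument τ)) := by
    rw [← intervalIntegral.integral_const_mul]
    congr 1
    funext τ
    rw [hzw _ (P.argument_mem τ)]
    ring
  have hpm : Real.pi ∈ Icc (0 : ℝ) Real.pi := ⟨Real.pi_pos.le, le_rfl⟩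
  rw [hI, hzw _ hpm, hw.eq _ hpm] at hchar
  unfold charRemainder
  have : c * μ ^ 2 ≠ 0 := mul_ne_zero hc (pow_ne_zero 2 hμ.ne')
  refine mul_left_cancel₀ this ?_
  rw [mul_zero]
  refine Eq.trans ?_ hchar
  field_simp
  ring

end RetardedProblem

/-! ### Decay of oscillatory integrals. -/

section Oscillatory

open MeasureTheory

/-- Integration by parts in disguise: with F the primitive of the integrand and G = q cos(c -
μφ)/(φ' μ), the derivative of F - G is O(1/μ), and so is G. The mean value inequality replaces the
integral of G', so `q'` and `φ''` need only be bounded, not integrable. It is applied on the open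
interval, and the endpoints are reached by continuity of F. -/
theorem abs_integral_mul_sin_sub_le {q q' φ φ' φ'' : ℝ → ℝ} {a b M M' M'' μ c : ℝ} (hab : a < b)
    (hμ : 0 < μ) (hq : ∀ x ∈ Ioo a b, HasDerivAt q (q' x) x)
    (hφ : ∀ x ∈ Ioo a b, HasDerivAt φ (φ' x) x) (hφ' : ∀ x ∈ Ioo a b, HasDerivAt φ' (φ'' x) x)
    (h1 : ∀ x ∈ Ioo a b, 1 ≤ φ' x) (hM : ∀ x ∈ Ioo a b, |q x| ≤ M)
    (hM' : ∀ x ∈ Ioo a b, |q' x| ≤ M') (hM'' : ∀ x ∈ Ioo a b, |φ'' x| ≤ M'')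
    (hint : IntervalIntegrable (fun t => q t * Real.sin (c - μ * φ t)) volume a b) :
    |∫ t in a..b, q t * Real.sin (c - μ * φ t)| ≤ (2 * M + (M' + M * M'') * (b - a)) / μ := by
  obtain ⟨f, hf⟩ : ∃ f, f = fun t => q t * Real.sin (c - μ * φ t) := ⟨_, rfl⟩
  obtain ⟨F, hF⟩ : ∃ F : ℝ → ℝ, F = fun x => ∫ t in a..x, f t := ⟨_, rfl⟩
  obtain ⟨G, hG⟩ : ∃ G : ℝ → ℝ, G = fun x => q x / φ' x * Real.cos (c - μ * φ x) / μ := ⟨_, rfl⟩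
  rw [← hf] at hint ⊢
  have hFc : ContinuousOn F (Icc a b) := by
    rw [hF, ← uIcc_of_le hab.le]
    exact intervalIntegral.continuousOn_primitive_interval' hint left_mem_uIcc
  have hfc : ContinuousOn f (Ioo a b) := by
    rw [hf]
    intro x hx
    have := (hq x hx).continuousAt
    have := (hφ x hx).continuousAt
    exact ContinuousAt.continuousWithinAt (by fun_prop)
  have hFd : ∀ x ∈ Ioo a b, HasDerivAt F (f x) x := fun x hx => by
    rw [hF]
    refine intervalIntegral.integral_hasDerivAt_right (hint.mono_set ?_)
      (hfc.stronglyMeasurableAtFilter isOpen_Ioo x hx)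
      ((hfc x hx).continuousAt (Ioo_mem_nhds hx.1 hx.2))
    rw [uIcc_of_le hx.1.le, uIcc_of_le hab.le]
    exact Icc_subset_Icc_right hx.2.le
  have hGd : ∀ x ∈ Ioo a b, HasDerivAt G ((q' x * φ' x - q x * φ'' x) / φ' x ^ 2 *
      Real.cos (c - μ * φ x) / μ + f x) x := fun x hx => by
    have hne : φ' x ≠ 0 := by linarith [h1 x hx]
    rw [hG, hf]
    have h2 := ((((hφ x hx).const_mul μ).const_sub c).cos)
    refine ((((hq x hx).div (hφ' x hx) hne).mul h2).div_const μ).congr_deriv ?_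
    rw [Pi.div_apply]
    field_simp
  have hGb : ∀ x ∈ Ioo a b, |G x| ≤ M / μ := fun x hx => by
    have h2 := h1 x hx
    have hM0 : 0 ≤ M := (abs_nonneg _).trans (hM x hx)
    rw [hG]
    simp only
    rw [abs_div, abs_of_pos hμ, abs_mul, abs_div, abs_of_pos (show 0 < φ' x by linarith)]
    gcongr
    calc |q x| / φ' x * |Real.cos (c - μ * φ x)| ≤ |q x| * 1 := by
          gcongr
          · exact div_le_self (abs_nonneg _) h2
          · exact Real.abs_cos_le_one _
      _ ≤ M := by rw [mul_one]; exact hM x hx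
  have hder : ∀ x ∈ Ioo a b, |f x - ((q' x * φ' x - q x * φ'' x) / φ' x ^ 2 *
      Real.cos (c - μ * φ x) / μ + f x)| ≤ (M' + M * M'') / μ := fun x hx => by
    have h2 := h1 x hx
    have hM0 : 0 ≤ M := (abs_nonneg _).trans (hM x hx)
    have hM0' : 0 ≤ M' := (abs_nonneg _).trans (hM' x hx)
    have hM0'' : 0 ≤ M'' := (abs_nonneg _).trans (hM'' x hx)
    have hpos : 0 < φ' x := by linarith
    rw [sub_add_cancel_right, abs_neg, abs_div, abs_of_pos hμ, abs_mul]
    gcongr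
    refine (mul_le_of_le_one_right (abs_nonneg _) (Real.abs_cos_le_one _)).trans ?_
    rw [abs_div, abs_of_pos (pow_pos hpos 2), div_le_iff₀ (pow_pos hpos 2)]
    calc |q' x * φ' x - q x * φ'' x| ≤ |q' x * φ' x| + |q x * φ'' x| := abs_sub _ _
      _ = |q' x| * φ' x + |q x| * |φ'' x| := by rw [abs_mul, abs_mul, abs_of_pos hpos]
      _ ≤ M' * φ' x ^ 2 + M * M'' * φ' x ^ 2 := by
          refine add_le_add ?_ ?_
          · refine mul_le_mul (hM' x hx) ?_ hpos.le hM0'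
            nlinarith
          · calc |q x| * |φ'' x| ≤ M * M'' :=
                  mul_le_mul (hM x hx) (hM'' x hx) (abs_nonneg _) hM0
              _ ≤ M * M'' * φ' x ^ 2 := le_mul_of_one_le_right (by positivity) (by nlinarith)
      _ = (M' + M * M'') * φ' x ^ 2 := by ring
  have hm : (a + b) / 2 ∈ Ioo a b := ⟨by linarith, by linarith⟩
  have hC0 : 0 ≤ (M' + M * M'') / μ := (abs_nonneg _).trans (hder _ hm)
  have hint2 : ∀ x ∈ Ioo a b, ∀ y ∈ Ioo a b,
      |F y - F x| ≤ (2 * M + (M' + M * M'') * (b - a)) / μ := fun x hx y hy => by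
    have h2 := (convex_Ioo a b).norm_image_sub_le_of_norm_hasDerivWithin_le
      (f := fun t => F t - G t)
      (fun t ht => ((hFd t ht).sub (hGd t ht)).hasDerivWithinAt) hder hx hy
    simp only [Real.norm_eq_abs] at h2
    have h3 : |y - x| ≤ b - a :=
      abs_le.mpr ⟨by linarith [hx.2, hy.1], by linarith [hx.1, hy.2]⟩
    have h4 := h2.trans (mul_le_mul_of_nonneg_left h3 hC0)
    have h5 := abs_le.mp (hGb x hx)
    have h6 := abs_le.mp (hGb y hy)
    have h7 := abs_le.mp h4
    have h8 : (2 * M + (M' + M * M'') * (b - a)) / μ =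
      M / μ + M / μ + (M' + M * M'') / μ * (b - a) := by ring
    rw [h8]
    exact abs_le.mpr ⟨by linarith, by linarith⟩
  have hta : Tendsto F (𝓝[Ioo a b] a) (𝓝 (F a)) :=
    (hFc a (left_mem_Icc.mpr hab.le)).mono Ioo_subset_Icc_self
  have htb : Tendsto F (𝓝[Ioo a b] b) (𝓝 (F b)) :=
    (hFc b (right_mem_Icc.mpr hab.le)).mono Ioo_subset_Icc_self
  have hna : (𝓝[Ioo a b] a).NeBot := by
    rw [← mem_closure_iff_nhdsWithin_neBot, closure_Ioo hab.ne]
    exact left_mem_Icc.mpr hab.le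
  have hnb : (𝓝[Ioo a b] b).NeBot := by
    rw [← mem_closure_iff_nhdsWithin_neBot, closure_Ioo hab.ne]
    exact right_mem_Icc.mpr hab.le
  have hb : ∀ x ∈ Ioo a b, |F b - F x| ≤ (2 * M + (M' + M * M'') * (b - a)) / μ := fun x hx =>
    le_of_tendsto (htb.sub_const _).abs (eventually_nhdsWithin_of_forall (hint2 x hx))
  have hfin : |F b - F a| ≤ (2 * M + (M' + M * M'') * (b - a)) / μ :=
    le_of_tendsto (hta.const_sub _).abs (eventually_nhdsWithin_of_forall hb)
  have hFa : F a = 0 := by rw [hF]; exact intervalIntegral.integral_same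
  rw [hFa, sub_zero, hF] at hfin
  exact hfin

end Oscillatory

/-! ### Leading term of the characteristic remainder. -/

namespace RetardedProblem

open MeasureTheory

variable {P : RetardedProblem}

theorem ConditionA.exists_potential_bound (ha : P.ConditionA) :
    ∃ M, 0 ≤ M ∧ ∀ x, |P.potential x| ≤ M := by
  obtain ⟨M', hM'⟩ := ha.q'_bounded
  have h1 := P.h₁_pos
  have h2 := P.h₁_lt_h₂
  have h3 := P.h₂_lt_pi
  have hM0 : 0 ≤ M' := (abs_nonneg _).trans (hM' 0 (Or.inl (Or.inl ⟨le_rfl, h1⟩)))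
  have key : ∀ s ⊆ P.domain, Convex ℝ s → ∀ x₀ ∈ s, ∀ x ∈ s,
      |P.q x| ≤ |P.q x₀| + M' * Real.pi := by
    intro s hs hconv x₀ hx₀ x hx
    have h := hconv.norm_image_sub_le_of_norm_hasDerivWithin_le
      (fun t ht => ((ha.q_diff t (hs ht)).hasDerivWithinAt).mono hs)
      (fun t ht => hM' t (hs ht)) hx₀ hx
    simp only [Real.norm_eq_abs] at h
    have hb : |x - x₀| ≤ Real.pi := by
      have e1 := P.domain_subset (hs hx)
      have e2 := P.domain_subset (hs hx₀)
      exact abs_le.mpr ⟨by linarith [e1.1, e2.2], by linarith [e1.2, e2.1]⟩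
    have h' := h.trans (mul_le_mul_of_nonneg_left hb hM0)
    have := abs_sub_abs_le_abs_sub (P.q x) (P.q x₀)
    linarith
  refine ⟨|P.q 0| + |P.q ((P.h₁ + P.h₂) / 2)| + |P.q Real.pi| + M' * Real.pi, by positivity,
    fun x => ?_⟩
  have e1 := abs_nonneg (P.q 0)
  have e2 := abs_nonneg (P.q ((P.h₁ + P.h₂) / 2))
  have e3 := abs_nonneg (P.q Real.pi)
  by_cases hx : x ∈ P.domain
  · rw [P.potential_of_mem hx]
    rcases hx with (hx | hx) | hx
    · have := key _ (fun t ht => Or.inl (Or.inl ht)) (convex_Ico 0 P.h₁) 0 ⟨le_rfl, h1⟩ x hx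
      linarith
    · have := key _ (fun t ht => Or.inl (Or.inr ht)) (convex_Ioo P.h₁ P.h₂) ((P.h₁ + P.h₂) / 2)
        ⟨by linarith, by linarith⟩ x hx
      linarith
    · have := key _ (fun t ht => Or.inr ht) (convex_Ioc P.h₂ Real.pi) Real.pi ⟨h3, le_rfl⟩ x hx
      linarith
  · rw [potential, indicator_of_notMem hx, abs_zero]
    positivity

theorem ConditionA.integrable_potential (ha : P.ConditionA) : Integrable P.potential := by
  obtain ⟨M, _, hM⟩ := ha.exists_potential_bound
  rw [potential, integrable_indicator_iff P.measurableSet_domain]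
  refine IntegrableOn.of_bound (C := M) ?_
    (P.q_continuousOn.aestronglyMeasurable P.measurableSet_domain) ?_
  · exact (measure_mono P.domain_subset).trans_lt measure_Icc_lt_top
  · refine (ae_restrict_iff' P.measurableSet_domain).mpr (Eventually.of_forall fun x hx => ?_)
    rw [← P.potential_of_mem hx]
    exact hM x

/-- On each piece the phase τ + σ = 2τ - Δ has derivative 2 - Δ' ≥ 1. The free constant `c` makes
the bound cover cosines as well, by a shift of π/2. -/
theorem abs_integral_potential_mul_sin_le (ha : P.ConditionA) (hb : P.ConditionB) :
    ∃ K, 0 ≤ K ∧ ∀ μ > 0, ∀ c, |∫ τ in (0 : ℝ)..Real.pi,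
      P.potential τ * Real.sin (c - μ * (τ + P.argument τ))| ≤ K / μ := by
  obtain ⟨M, hM0, hM⟩ := ha.exists_potential_bound
  obtain ⟨M', hM'⟩ := ha.q'_bounded
  obtain ⟨M'', hM''⟩ := ha.Δ''_bounded
  have h1 := P.h₁_pos
  have h2 := P.h₁_lt_h₂
  have h3 := P.h₂_lt_pi
  have hd0 : (0 : ℝ) ∈ P.domain := Or.inl (Or.inl ⟨le_rfl, h1⟩)
  have hM0' : 0 ≤ M' := (abs_nonneg _).trans (hM' 0 hd0)
  have hM0'' : 0 ≤ M'' := (abs_nonneg _).trans (hM'' 0 hd0)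
  have hint : ∀ μ c a b, IntervalIntegrable
      (fun τ => P.potential τ * Real.sin (c - μ * (τ + P.argument τ))) volume a b :=
    fun μ c a b => (integrable_mul_of_abs_le ha.integrable_potential
      (by have := P.measurable_argument; fun_prop)
      (fun t => Real.abs_sin_le_one _)).intervalIntegrable
  have key : ∀ a b, a < b → (∀ x ∈ Ioo a b, x ∈ Ioo 0 Real.pi \ {P.h₁, P.h₂}) → b - a ≤ Real.pi →
      ∀ μ > 0, ∀ c, |∫ τ in a..b, P.potential τ * Real.sin (c - μ * (τ + P.argument τ))| ≤
        (2 * M + (M' + M * M'') * Real.pi) / μ := by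
    intro a b hab hsub hlen μ hμ c
    have hdom : ∀ x ∈ Ioo a b, P.domain ∈ 𝓝 x := fun x hx => P.domain_mem_nhds (hsub x hx)
    have hmem : ∀ x ∈ Ioo a b, x ∈ P.domain := fun x hx => mem_of_mem_nhds (hdom x hx)
    refine (abs_integral_mul_sin_sub_le (M := M) (M' := M') (M'' := M'')
      (q' := derivWithin P.q P.domain)
      (φ' := fun x => 2 - derivWithin P.Δ P.domain x)
      (φ'' := fun x => -derivWithin (derivWithin P.Δ P.domain) P.domain x) hab hμ
      (fun x hx => ?_) (fun x hx => ?_) (fun x hx => ?_) (fun x hx => ?_) (fun x _ => hM x)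
      (fun x hx => hM' x (hmem x hx)) (fun x hx => ?_) (hint μ c a b)).trans ?_
    · refine ((ha.q_diff x (hmem x hx)).hasDerivWithinAt.hasDerivAt (hdom x hx)).congr_of_eventuallyEq
        ?_
      filter_upwards [hdom x hx] with t ht using P.potential_of_mem ht
    · have hd := (ha.Δ_diff x (hmem x hx)).hasDerivWithinAt.hasDerivAt (hdom x hx)
      have h4 := ((hasDerivAt_id x).const_mul 2).sub hd
      refine (h4.congr_of_eventuallyEq ?_).congr_deriv (by ring)
      filter_upwards [hdom x hx] with t ht
      rw [P.argument_of_mem ht]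
      simp only [Pi.sub_apply, id]
      ring
    · exact ((ha.Δ'_diff x (hmem x hx)).hasDerivWithinAt.hasDerivAt (hdom x hx)).const_sub 2
    · have := hb.Δ'_le_one x (hmem x hx)
      linarith
    · rw [abs_neg]
      exact hM'' x (hmem x hx)
    · gcongr
  refine ⟨3 * (2 * M + (M' + M * M'') * Real.pi), by positivity, fun μ hμ c => ?_⟩
  have k1 := key 0 P.h₁ h1 (fun x hx => ⟨⟨hx.1, by linarith [hx.2]⟩, by
    simp only [mem_insert_iff, mem_singleton_iff, not_or]
    exact ⟨hx.2.ne, (hx.2.trans h2).ne⟩⟩) (by linarith) μ hμ c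
  have k2 := key P.h₁ P.h₂ h2 (fun x hx => ⟨⟨by linarith [hx.1], by linarith [hx.2]⟩, by
    simp only [mem_insert_iff, mem_singleton_iff, not_or]
    exact ⟨hx.1.ne', hx.2.ne⟩⟩) (by linarith) μ hμ c
  have k3 := key P.h₂ Real.pi h3 (fun x hx => ⟨⟨by linarith [hx.1], hx.2⟩, by
    simp only [mem_insert_iff, mem_singleton_iff, not_or]
    exact ⟨(h2.trans hx.1).ne', hx.1.ne'⟩⟩) (by linarith) μ hμ c
  rw [← intervalIntegral.integral_add_adjacent_intervals (hint μ c 0 P.h₂) (hint μ c P.h₂ _),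
    ← intervalIntegral.integral_add_adjacent_intervals (hint μ c 0 P.h₁) (hint μ c P.h₁ _)]
  refine (abs_add_three _ _ _).trans ?_
  rw [mul_div_assoc]
  linarith

theorem abs_charRemainder_sub_le (ha : P.ConditionA) (hb : P.ConditionB) :
    ∃ K, 0 ≤ K ∧ ∀ μ, 0 < μ → 2 * (∫ t, |P.potential t|) ≤ μ → ∀ z,
      IsVolterraSolution P.potential P.argument μ 1 z →
      |charRemainder P.potential P.argument μ z -
        ((Real.sin (μ * Real.pi) + Real.cos (μ * Real.pi)) + 1 / 2 * ∫ τ in (0 : ℝ)..Real.pi,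
          P.potential τ * (Real.sin (μ * Real.pi - μ * (τ - P.argument τ)) +
            Real.cos (μ * Real.pi - μ * (τ - P.argument τ))))| ≤ K / μ := by
  obtain ⟨K, hK0, hK⟩ := abs_integral_potential_mul_sin_le ha hb
  have hQ := ha.integrable_potential
  have hσ := P.measurable_argument
  set Q := P.potential
  set σ := P.argument
  set κ := ∫ t, |Q t| with hκ
  have hκ0 : 0 ≤ κ := integral_nonneg fun t => abs_nonneg _
  -- The summands pay for replacing `z` by cos - sin, for the two oscillatory integrals (each with
  -- factor 1/2), and for the cosine integral carrying 1/μ.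
  refine ⟨4 * κ ^ 2 + K + 4 * κ, by positivity, fun μ hμ hμQ z hz => ?_⟩
  have hz4 := hz.abs_apply_le hQ P.argument_mem hμ hμQ
  have hzm := measurable_comp_of_continuousOn_Icc hσ P.argument_mem hz.continuousOn
  have happrox : ∀ x ∈ Icc (0 : ℝ) Real.pi,
      |z x - (Real.cos (μ * x) - Real.sin (μ * x))| ≤ 4 * κ / μ := fun x hx => by
    have h : |∫ τ in (0 : ℝ)..x, Q τ * (Real.sin (μ * (x - τ)) * z (σ τ))| ≤ κ * 4 :=
      abs_intervalIntegral_mul_le hQ (by norm_num) (abs_sin_mul_le _ fun t =>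
        hz4 _ (P.argument_mem t))
    rw [hz.eq x hx, one_mul, sub_sub_cancel_left, abs_neg, abs_mul,
      abs_of_pos (one_div_pos.mpr hμ), one_div_mul_eq_div, mul_comm 4 κ]
    gcongr
  have hI : ∀ {w : ℝ → ℝ} {C : ℝ}, Measurable w → (∀ t, |w t| ≤ C) →
      IntervalIntegrable (fun τ => Q τ * w τ) volume 0 Real.pi := fun hw hC =>
    (integrable_mul_of_abs_le hQ hw hC).intervalIntegrable
  obtain ⟨e, he⟩ : ∃ e : ℝ → ℝ, e = fun τ => Real.sin (μ * (Real.pi - τ)) *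
    (z (σ τ) - (Real.cos (μ * σ τ) - Real.sin (μ * σ τ))) := ⟨_, rfl⟩
  have heC : ∀ t, |e t| ≤ 4 * κ / μ := by
    rw [he]
    exact abs_sin_mul_le _ fun t => happrox _ (P.argument_mem t)
  have hem : Measurable e := by
    rw [he]
    exact Measurable.mul (by fun_prop) (hzm.sub (by fun_prop))
  have he_int : |∫ τ in (0 : ℝ)..Real.pi, Q τ * e τ| ≤ κ * (4 * κ / μ) :=
    abs_intervalIntegral_mul_le hQ (by positivity) heC
  obtain ⟨W, hW⟩ : ∃ W : ℝ → ℝ, W = fun τ => Real.sin (μ * Real.pi - μ * (τ - σ τ)) +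
    Real.cos (μ * Real.pi - μ * (τ - σ τ)) := ⟨_, rfl⟩
  have hWm : Measurable W := by
    rw [hW]
    fun_prop
  have hWC : ∀ t, |W t| ≤ 2 := fun t => by
    rw [hW]
    refine (abs_add_le _ _).trans ?_
    have h1 := Real.abs_sin_le_one (μ * Real.pi - μ * (t - σ t))
    have h2 := Real.abs_cos_le_one (μ * Real.pi - μ * (t - σ t))
    linarith
  -- Product-to-sum formulas: `W` collects the phase τ - σ, and the last two integrals have the
  -- phase τ + σ, the cosine being written as a shifted sine.
  have hsplit : ∫ τ in (0 : ℝ)..Real.pi, Q τ * (Real.sin (μ * (Real.pi - τ)) * z (σ τ)) =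
      (∫ τ in (0 : ℝ)..Real.pi, Q τ * e τ) + 1 / 2 * ((∫ τ in (0 : ℝ)..Real.pi, Q τ * W τ) +
      ((∫ τ in (0 : ℝ)..Real.pi, Q τ * Real.sin (μ * Real.pi - μ * (τ + σ τ))) -
      ∫ τ in (0 : ℝ)..Real.pi, Q τ * Real.sin (μ * Real.pi + Real.pi / 2 - μ * (τ + σ τ)))) := by
    have i1 := hI hem heC
    have i2 := hI hWm hWC
    have i3 := hI (w := fun τ => Real.sin (μ * Real.pi - μ * (τ + σ τ))) (by fun_prop)
      (fun t => Real.abs_sin_le_one _)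
    have i4 := hI (w := fun τ => Real.sin (μ * Real.pi + Real.pi / 2 - μ * (τ + σ τ)))
      (by fun_prop) (fun t => Real.abs_sin_le_one _)
    rw [← intervalIntegral.integral_sub i3 i4, ← intervalIntegral.integral_add i2 (i3.sub i4),
      ← intervalIntegral.integral_const_mul,
      ← intervalIntegral.integral_add i1 ((i2.add (i3.sub i4)).const_mul _)]
    congr 1
    funext τ
    have t1 : Real.sin (μ * Real.pi + Real.pi / 2 - μ * (τ + σ τ)) =
        Real.cos (μ * (Real.pi - τ) - μ * σ τ) := by
      rw [← Real.sin_add_pi_div_two]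
      congr 1
      ring
    have t2 : μ * Real.pi - μ * (τ + σ τ) = μ * (Real.pi - τ) - μ * σ τ := by ring
    have t3 : μ * Real.pi - μ * (τ - σ τ) = μ * (Real.pi - τ) + μ * σ τ := by ring
    rw [he, hW]
    simp only
    rw [t1, t2, t3, Real.sin_add, Real.cos_add, Real.sin_sub, Real.cos_sub]
    ring
  have hk1 := hK μ hμ (μ * Real.pi)
  have hk2 := hK μ hμ (μ * Real.pi + Real.pi / 2)
  have hc4 : |∫ τ in (0 : ℝ)..Real.pi, Q τ * (Real.cos (μ * (Real.pi - τ)) * z (σ τ))| ≤ κ * 4 :=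
    abs_intervalIntegral_mul_le hQ (by norm_num) (abs_cos_mul_le _ fun t =>
      hz4 _ (P.argument_mem t))
  have hc5 : |1 / μ * ∫ τ in (0 : ℝ)..Real.pi, Q τ * (Real.cos (μ * (Real.pi - τ)) * z (σ τ))| ≤
      κ * 4 / μ := by
    rw [abs_mul, abs_of_pos (one_div_pos.mpr hμ), one_div_mul_eq_div]
    gcongr
  unfold charRemainder
  rw [hsplit, show (∫ τ in (0 : ℝ)..Real.pi, Q τ *
    (Real.sin (μ * Real.pi - μ * (τ - σ τ)) + Real.cos (μ * Real.pi - μ * (τ - σ τ)))) =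
    ∫ τ in (0 : ℝ)..Real.pi, Q τ * W τ by rw [hW]]
  have hfin : (4 * κ ^ 2 + K + 4 * κ) / μ = κ * (4 * κ / μ) + K / μ + κ * 4 / μ := by ring
  rw [hfin]
  rw [abs_le] at he_int hk1 hk2 hc5 ⊢
  constructor <;> linarith

end RetardedProblem

/-! ### Zeros of the characteristic equation near N + 1/4. -/

section Asymptotics

open MeasureTheory

theorem cos_sub_sin_near (N : ℕ) (ε : ℝ) :
    Real.cos (((N : ℝ) + 1 / 4 + ε) * Real.pi) - Real.sin (((N : ℝ) + 1 / 4 + ε) * Real.pi) =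
      -((-1) ^ N * √2 * Real.sin (Real.pi * ε)) := by
  have h : ((N : ℝ) + 1 / 4 + ε) * Real.pi = (Real.pi / 4 + Real.pi * ε) + N * Real.pi := by ring
  rw [h, Real.cos_add_nat_mul_pi, Real.sin_add_nat_mul_pi, Real.cos_add, Real.sin_add,
    Real.cos_pi_div_four, Real.sin_pi_div_four]
  ring

theorem sin_add_cos_near (N : ℕ) (ε x : ℝ) :
    Real.sin (((N : ℝ) + 1 / 4 + ε) * Real.pi - x) +
      Real.cos (((N : ℝ) + 1 / 4 + ε) * Real.pi - x) =
      (-1) ^ N * √2 * Real.cos (Real.pi * ε - x) := by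
  have h : ((N : ℝ) + 1 / 4 + ε) * Real.pi - x =
    (Real.pi / 4 + (Real.pi * ε - x)) + N * Real.pi := by ring
  rw [h, Real.cos_add_nat_mul_pi, Real.sin_add_nat_mul_pi, Real.cos_add, Real.sin_add,
    Real.cos_pi_div_four, Real.sin_pi_div_four]
  ring

theorem neg_one_pow_mul_self (N : ℕ) : (-1 : ℝ) ^ N * (-1) ^ N = 1 := by
  rw [← mul_pow]
  norm_num

theorem abs_neg_one_pow_mul_sqrt_two (N : ℕ) : |(-1 : ℝ) ^ N * √2| = √2 := by
  rw [abs_mul, abs_pow, abs_neg, abs_one, one_pow, one_mul, abs_of_nonneg (Real.sqrt_nonneg _)]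

theorem two_mul_abs_le_abs_sin_pi_mul {ε : ℝ} (h : |ε| ≤ 1 / 2) :
    2 * |ε| ≤ |Real.sin (Real.pi * ε)| := by
  have h1 := Real.mul_le_sin (x := Real.pi * |ε|) (by positivity) (by nlinarith [Real.pi_pos])
  have h2 : 2 / Real.pi * (Real.pi * |ε|) = 2 * |ε| := by
    field_simp
  rw [h2] at h1
  refine h1.trans ?_
  rcases abs_cases ε with ⟨h3, _⟩ | ⟨h3, _⟩
  · rw [h3]
    exact le_abs_self _
  · rw [h3, mul_neg, Real.sin_neg]
    exact neg_le_abs _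

/-- In sin a - sin b = 2 sin((a - b)/2) cos((a + b)/2), Jordan's inequality bounds the sine from
below, and the cosine is at least 1/2 because its argument is at most π/4 < 1 in absolute value. -/
theorem abs_sub_le_abs_sin_pi_mul_sub {ε η : ℝ} (hε : |ε| ≤ 1 / 4) (hη : |η| ≤ 1 / 4) :
    |ε - η| ≤ |Real.sin (Real.pi * ε) - Real.sin (Real.pi * η)| := by
  rw [abs_le] at hε hη
  have hpi := Real.pi_pos
  have hpi2 := Real.pi_lt_d2
  have h1 : 2 * |(ε - η) / 2| ≤ |Real.sin (Real.pi * ((ε - η) / 2))| :=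
    two_mul_abs_le_abs_sin_pi_mul (abs_le.mpr ⟨by linarith, by linarith⟩)
  have h2 : 1 / 2 ≤ Real.cos (Real.pi * ((ε + η) / 2)) := by
    have h3 := Real.one_sub_sq_div_two_le_cos (x := Real.pi * ((ε + η) / 2))
    have h4 : |Real.pi * ((ε + η) / 2)| ≤ 1 := by
      rw [abs_mul, abs_of_pos hpi]
      have : |(ε + η) / 2| ≤ 1 / 4 := abs_le.mpr ⟨by linarith, by linarith⟩
      nlinarith
    have h5 := sq_le_one_iff_abs_le_one _ |>.mpr h4
    linarith
  rw [Real.sin_sub_sin, abs_mul, abs_mul, abs_two]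
  have e1 : (Real.pi * ε - Real.pi * η) / 2 = Real.pi * ((ε - η) / 2) := by ring
  have e2 : (Real.pi * ε + Real.pi * η) / 2 = Real.pi * ((ε + η) / 2) := by ring
  rw [e1, e2, abs_of_pos (a := Real.cos _) (by linarith)]
  rw [abs_div, abs_two] at h1
  have h6 : 2 * |Real.sin (Real.pi * ((ε - η) / 2))| * (1 / 2) ≤
      2 * |Real.sin (Real.pi * ((ε - η) / 2))| * Real.cos (Real.pi * ((ε + η) / 2)) := by
    gcongr
  linarith

theorem abs_div_sub_div_le_of_lipschitz {E : ℝ → ℝ} {C N μ ν : ℝ} (hN : 1 ≤ N) (hμ : N ≤ μ)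
    (hν : N ≤ ν) (hEν : |E ν| ≤ C) (hL : |E μ - E ν| ≤ C * |μ - ν|) :
    |E μ / μ - E ν / ν| ≤ 2 * C / N * |μ - ν| := by
  have hN0 : 0 < N := by linarith
  have hμ0 : 0 < μ := by linarith
  have hC : 0 ≤ C := (abs_nonneg _).trans hEν
  have h : E μ / μ - E ν / ν = (E μ - E ν) / μ + (1 / μ - 1 / ν) * E ν := by ring
  have h1 : |(E μ - E ν) / μ| ≤ C * |μ - ν| / N := by
    rw [abs_div, abs_of_pos hμ0]
    gcongr
  have h2 : |(1 / μ - 1 / ν) * E ν| ≤ |μ - ν| / N * C := by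
    rw [abs_mul]
    refine mul_le_mul ?_ hEν (abs_nonneg _) (by positivity)
    refine (abs_one_div_sub_one_div_le (hN.trans hμ) (hN.trans hν)).trans ?_
    gcongr
  rw [h]
  refine (abs_add_le _ _).trans ((add_le_add h1 h2).trans (le_of_eq ?_))
  ring

/-- Intermediate value theorem: up to the sign (-1)^N, cos - sin is 1 at N and -1 at N + 1/2, while
|E/μ| < 1. -/
theorem exists_zero_near {E : ℝ → ℝ} {C : ℝ} {N : ℕ} (hN : 1 ≤ (N : ℝ)) (hNC : 2 * C < N)
    (hE : ∀ μ, (N : ℝ) ≤ μ → |E μ| ≤ C)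
    (hL : ∀ μ ν, (N : ℝ) ≤ μ → (N : ℝ) ≤ ν → |E μ - E ν| ≤ C * |μ - ν|) :
    ∃ μ, |(N : ℝ) + 1 / 4 - μ| < 1 / 4 ∧
      Real.cos (μ * Real.pi) - Real.sin (μ * Real.pi) - E μ / μ = 0 := by
  have hN0 : (0 : ℝ) < N := by linarith
  have hEc : ContinuousOn E (Icc (N : ℝ) (N + 1 / 2)) :=
    (LipschitzOnWith.of_dist_le_mul (K := C.toNNReal) fun μ hμ ν hν => by
      rw [Real.dist_eq, Real.dist_eq]
      refine (hL μ ν hμ.1 hν.1).trans ?_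
      gcongr
      exact Real.le_coe_toNNReal C).continuousOn
  obtain ⟨f, hf⟩ : ∃ f : ℝ → ℝ, f = fun μ => (-1) ^ N *
    (Real.cos (μ * Real.pi) - Real.sin (μ * Real.pi) - E μ / μ) := ⟨_, rfl⟩
  have hfc : ContinuousOn f (Icc (N : ℝ) (N + 1 / 2)) := by
    rw [hf]
    refine continuousOn_const.mul (ContinuousOn.sub (by fun_prop)
      (hEc.div continuousOn_id fun μ hμ => ?_))
    exact (hN0.trans_le hμ.1).ne'
  have hsmall : ∀ μ, (N : ℝ) ≤ μ → |(-1) ^ N * (E μ / μ)| < 1 := fun μ hμ => by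
    have hμ0 : 0 < μ := by linarith
    rw [abs_mul, abs_pow, abs_neg, abs_one, one_pow, one_mul, abs_div, abs_of_pos hμ0,
      div_lt_one hμ0]
    linarith [hE μ hμ, abs_nonneg (E μ)]
  have hsN := neg_one_pow_mul_self N
  have hfl : 0 < f N := by
    have h1 := Real.cos_add_nat_mul_pi 0 N
    have h2 := Real.sin_add_nat_mul_pi 0 N
    rw [zero_add, Real.cos_zero, mul_one] at h1
    rw [zero_add, Real.sin_zero, mul_zero] at h2
    have h3 := (abs_lt.mp (hsmall N le_rfl)).2
    rw [hf]
    simp only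
    rw [h1, h2]
    linarith
  have hfr : f (N + 1 / 2) < 0 := by
    have h1 := Real.cos_add_nat_mul_pi (Real.pi / 2) N
    have h2 := Real.sin_add_nat_mul_pi (Real.pi / 2) N
    have h0 : Real.pi / 2 + N * Real.pi = ((N : ℝ) + 1 / 2) * Real.pi := by ring
    rw [h0, Real.cos_pi_div_two, mul_zero] at h1
    rw [h0, Real.sin_pi_div_two, mul_one] at h2
    have h3 := (abs_lt.mp (hsmall (N + 1 / 2) (by linarith))).1
    rw [hf]
    simp only
    rw [h1, h2]
    linarith
  obtain ⟨μ, hμ, hfμ⟩ := intermediate_value_Ioo' (by linarith : (N : ℝ) ≤ N + 1 / 2) hfc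
    ⟨hfr, hfl⟩
  refine ⟨μ, abs_lt.mpr ⟨by linarith [hμ.2], by linarith [hμ.1]⟩, ?_⟩
  rw [hf] at hfμ
  exact (mul_eq_zero.mp hfμ).resolve_left (pow_ne_zero _ (by norm_num))

/-- E/μ has Lipschitz constant 2C/N < 1 on the window, whereas √2 sin πε separates points by at
least their distance. -/
theorem zero_near_unique {E : ℝ → ℝ} {C : ℝ} {N : ℕ} (hN : 1 ≤ (N : ℝ)) (hNC : 2 * C < N)
    (hE : ∀ μ, (N : ℝ) ≤ μ → |E μ| ≤ C)
    (hL : ∀ μ ν, (N : ℝ) ≤ μ → (N : ℝ) ≤ ν → |E μ - E ν| ≤ C * |μ - ν|) {μ ν : ℝ}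
    (hμ : |(N : ℝ) + 1 / 4 - μ| < 1 / 4) (hν : |(N : ℝ) + 1 / 4 - ν| < 1 / 4)
    (hμ0 : Real.cos (μ * Real.pi) - Real.sin (μ * Real.pi) - E μ / μ = 0)
    (hν0 : Real.cos (ν * Real.pi) - Real.sin (ν * Real.pi) - E ν / ν = 0) : ν = μ := by
  obtain ⟨ε, rfl⟩ : ∃ ε, μ = N + 1 / 4 + ε := ⟨μ - (N + 1 / 4), by ring⟩
  obtain ⟨η, rfl⟩ : ∃ η, ν = N + 1 / 4 + η := ⟨ν - (N + 1 / 4), by ring⟩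
  rw [sub_add_cancel_left, abs_neg] at hμ hν
  have hμ' := abs_lt.mp hμ
  have hν' := abs_lt.mp hν
  have hN0 : (0 : ℝ) < N := by linarith
  have hdiff := abs_div_sub_div_le_of_lipschitz (E := E) (C := C) hN
    (by linarith : (N : ℝ) ≤ N + 1 / 4 + ε) (by linarith : (N : ℝ) ≤ N + 1 / 4 + η)
    (hE _ (by linarith)) (hL _ _ (by linarith) (by linarith))
  rw [cos_sub_sin_near] at hμ0 hν0
  have h1 : E (N + 1 / 4 + ε) / (N + 1 / 4 + ε) - E (N + 1 / 4 + η) / (N + 1 / 4 + η) =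
      -((-1) ^ N * √2 * (Real.sin (Real.pi * ε) - Real.sin (Real.pi * η))) := by
    linear_combination hν0 - hμ0
  rw [h1, abs_neg, abs_mul, abs_neg_one_pow_mul_sqrt_two] at hdiff
  have h2 := abs_sub_le_abs_sin_pi_mul_sub hμ.le hν.le
  have h3 : (1 : ℝ) ≤ √2 := Real.one_le_sqrt.mpr (by norm_num)
  have h4 : |ε - η| ≤ √2 * |Real.sin (Real.pi * ε) - Real.sin (Real.pi * η)| :=
    h2.trans (le_mul_of_one_le_left (abs_nonneg _) h3)
  have h5 : N + 1 / 4 + ε - (N + 1 / 4 + η) = ε - η := by ring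
  rw [h5] at hdiff
  have h6 : 2 * C / N < 1 := (div_lt_one hN0).mpr hNC
  have h7 : |ε - η| = 0 := by
    by_contra hne
    have hpos : 0 < |ε - η| := lt_of_le_of_ne (abs_nonneg _) (Ne.symm hne)
    nlinarith
  have h8 := sub_eq_zero.mp (abs_eq_zero.mp h7)
  rw [h8]

theorem abs_zero_near_sub_le {Q ρ : ℝ → ℝ} (hQ : Integrable Q) (hρ : Measurable ρ)
    (hρpi : ∀ t ∈ Icc (0 : ℝ) Real.pi, |ρ t| ≤ Real.pi) {K : ℝ} (hK : 0 ≤ K) :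
    ∃ B, ∀ (N : ℕ) (μ e : ℝ), 1 ≤ (N : ℝ) → |(N : ℝ) + 1 / 4 - μ| < 1 / 4 →
      |e - ((Real.sin (μ * Real.pi) + Real.cos (μ * Real.pi)) + 1 / 2 * ∫ τ in (0 : ℝ)..Real.pi,
          Q τ * (Real.sin (μ * Real.pi - μ * ρ τ) + Real.cos (μ * Real.pi - μ * ρ τ)))| ≤ K / μ →
      Real.cos (μ * Real.pi) - Real.sin (μ * Real.pi) - e / μ = 0 →
      |μ - ((N : ℝ) + 1 / 4 - 2 / (Real.pi * (4 * (N : ℝ) + 1)) *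
        (2 + ∫ τ in (0 : ℝ)..Real.pi, Q τ * Real.cos (((N : ℝ) + 1 / 4) * ρ τ)))| ≤
      B * (1 / (N : ℝ) ^ 2) := by
  set κ := ∫ t, |Q t| with hκ
  have hκ0 : 0 ≤ κ := integral_nonneg fun t => abs_nonneg _
  -- `D` bounds the bracket cos πε + J/2 + r in the equation for sin πε, whence |ε| ≤ D/N.
  obtain ⟨D, hD⟩ : ∃ D, D = 1 + κ + K := ⟨_, rfl⟩
  have hD1 : 1 ≤ D := by rw [hD]; linarith
  refine ⟨16 * D ^ 2 + (4 * D + 4 * κ * D) + D * (1 + κ) + K, fun N μ e hN hμN he h0 => ?_⟩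
  obtain ⟨ε, rfl⟩ : ∃ ε, μ = N + 1 / 4 + ε := ⟨μ - (N + 1 / 4), by ring⟩
  rw [sub_add_cancel_left, abs_neg] at hμN
  obtain ⟨μ, hμ⟩ : ∃ μ, μ = N + 1 / 4 + ε := ⟨_, rfl⟩
  obtain ⟨s, hs⟩ : ∃ s : ℝ, s = (-1) ^ N * √2 := ⟨_, rfl⟩
  have hsabs : |s| = √2 := by rw [hs, abs_neg_one_pow_mul_sqrt_two]
  have hs1 : 1 ≤ |s| := by rw [hsabs]; exact Real.one_le_sqrt.mpr (by norm_num)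
  have hs0 : s ≠ 0 := fun h => by rw [h, abs_zero] at hs1; linarith
  have hε := abs_lt.mp hμN
  have hpi := Real.pi_pos
  have hpi2 := Real.pi_lt_d2
  have hpi3 := Real.pi_gt_three
  have hN0 : (0 : ℝ) < N := by linarith
  have hμN' : N ≤ μ := by rw [hμ]; linarith
  have hμ0 : 0 < μ := by linarith
  have hIcos : ∀ f : ℝ → ℝ, Measurable f →
      IntervalIntegrable (fun τ => Q τ * Real.cos (f τ)) volume 0 Real.pi := fun f hf =>
    (integrable_mul_of_abs_le hQ (by fun_prop) fun t => Real.abs_cos_le_one _).intervalIntegrable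
  obtain ⟨J, hJ⟩ : ∃ J, J = ∫ τ in (0 : ℝ)..Real.pi, Q τ * Real.cos (Real.pi * ε - μ * ρ τ) :=
    ⟨_, rfl⟩
  obtain ⟨I, hI⟩ : ∃ I, I = ∫ τ in (0 : ℝ)..Real.pi,
    Q τ * Real.cos (((N : ℝ) + 1 / 4) * ρ τ) := ⟨_, rfl⟩
  have hJκ : |J| ≤ κ := by
    rw [hJ, ← mul_one κ]
    exact abs_intervalIntegral_mul_le hQ zero_le_one fun t => Real.abs_cos_le_one _
  have hIκ : |I| ≤ κ := by
    rw [hI, ← mul_one κ]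
    exact abs_intervalIntegral_mul_le hQ zero_le_one fun t => Real.abs_cos_le_one _
  have hIJ : |J - I| ≤ κ * (2 * Real.pi * |ε|) := by
    rw [hJ, hI, ← intervalIntegral.integral_sub (hIcos _ (by fun_prop)) (hIcos _ (by fun_prop))]
    simp only [← mul_sub]
    refine abs_intervalIntegral_mul_le_of_mem hQ ⟨hpi.le, le_rfl⟩ (by positivity) fun t ht => ?_
    rw [← Real.cos_neg (Real.pi * ε - μ * ρ t)]
    refine (Real.abs_cos_sub_cos_le _ _).trans ?_
    -- Freezing μ at N + 1/4 moves the phase by O(ε) only, because ρ is bounded by π.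
    have : -(Real.pi * ε - μ * ρ t) - (N + 1 / 4) * ρ t = (ρ t - Real.pi) * ε := by
      rw [hμ]
      ring
    rw [this, abs_mul]
    gcongr
    refine (abs_sub _ _).trans ?_
    rw [abs_of_pos hpi]
    linarith [hρpi t ht]
  rw [← hI]
  rw [cos_sub_sin_near, ← hs, ← hμ] at h0
  have hW : (Real.sin ((N + 1 / 4 + ε) * Real.pi) + Real.cos ((N + 1 / 4 + ε) * Real.pi)) +
      1 / 2 * ∫ τ in (0 : ℝ)..Real.pi, Q τ * (Real.sin ((N + 1 / 4 + ε) * Real.pi -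
        (N + 1 / 4 + ε) * ρ τ) + Real.cos ((N + 1 / 4 + ε) * Real.pi - (N + 1 / 4 + ε) * ρ τ)) =
      s * (Real.cos (Real.pi * ε) + 1 / 2 * J) := by
    have h1 := sin_add_cos_near N ε 0
    rw [sub_zero, sub_zero, ← hs] at h1
    simp only [sin_add_cos_near N ε]
    rw [h1, ← hs, ← hμ, hJ]
    have : ∫ τ in (0 : ℝ)..Real.pi, Q τ * (s * Real.cos (Real.pi * ε - μ * ρ τ)) =
        s * ∫ τ in (0 : ℝ)..Real.pi, Q τ * Real.cos (Real.pi * ε - μ * ρ τ) := by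
      rw [← intervalIntegral.integral_const_mul]
      congr 1
      funext τ
      ring
    rw [this]
    ring
  rw [hW, ← hμ] at he
  obtain ⟨r, hr⟩ : ∃ r, r = e / s - (Real.cos (Real.pi * ε) + 1 / 2 * J) := ⟨_, rfl⟩
  have hrK : |r| ≤ K / N := by
    have h1 : r = (e - s * (Real.cos (Real.pi * ε) + 1 / 2 * J)) / s := by
      rw [hr]
      field_simp
    rw [h1, abs_div]
    refine (div_le_self (abs_nonneg _) hs1).trans (he.trans ?_)
    gcongr
  have hsin : Real.sin (Real.pi * ε) = -(1 / μ * (Real.cos (Real.pi * ε) + 1 / 2 * J + r)) := by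
    rw [hr]
    have : s * Real.sin (Real.pi * ε) = -(e / μ) := by linarith
    apply mul_left_cancel₀ hs0
    rw [this]
    field_simp
    ring
  have hKN : K / N ≤ K := div_le_self hK hN
  have hεD : |ε| ≤ D / N := by
    have h1 := two_mul_abs_le_abs_sin_pi_mul (ε := ε) (by linarith)
    have h2 : |Real.sin (Real.pi * ε)| ≤ D / N := by
      rw [hsin, abs_neg, abs_mul, abs_of_pos (one_div_pos.mpr hμ0), one_div_mul_eq_div]
      have h3 : |Real.cos (Real.pi * ε) + 1 / 2 * J + r| ≤ D := by
        have a1 := abs_le.mp (Real.abs_cos_le_one (Real.pi * ε))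
        have a2 := abs_le.mp hJκ
        have a3 := abs_le.mp hrK
        rw [hD]
        exact abs_le.mpr ⟨by linarith, by linarith⟩
      gcongr
    linarith [abs_nonneg ε]
  have hπε : |Real.pi * ε| ≤ 4 * (D / N) := by
    rw [abs_mul, abs_of_pos hpi]
    gcongr
    linarith
  have b1 : |Real.pi * ε - Real.sin (Real.pi * ε)| ≤ 16 * D ^ 2 / N ^ 2 := by
    have h1 := Real.abs_sub_sin_le (Real.pi * ε)
    have h2 : |Real.pi * ε| ≤ 1 := by
      rw [abs_mul, abs_of_pos hpi]
      nlinarith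
    have h3 : |Real.pi * ε| ^ 2 ≤ (4 * (D / N)) ^ 2 := by gcongr
    have h4 : |Real.pi * ε| ^ 3 ≤ |Real.pi * ε| ^ 2 :=
      pow_le_pow_of_le_one (abs_nonneg _) h2 (by norm_num)
    have h5 : (4 * (D / N)) ^ 2 = 16 * D ^ 2 / N ^ 2 := by ring
    rw [h5] at h3
    have : 0 ≤ |Real.pi * ε| ^ 3 := by positivity
    linarith
  have b2 : |1 / μ * ((Real.cos (Real.pi * ε) - 1) + 1 / 2 * (J - I))| ≤
      (4 * D + 4 * κ * D) / N ^ 2 := by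
    have h1 := Real.abs_cos_sub_cos_le (Real.pi * ε) 0
    rw [Real.cos_zero, sub_zero] at h1
    have h2 : |(Real.cos (Real.pi * ε) - 1) + 1 / 2 * (J - I)| ≤ (4 * D + 4 * κ * D) / N := by
      refine (abs_add_le _ _).trans ?_
      have h3 : |1 / 2 * (J - I)| ≤ κ * (4 * (D / N)) := by
        rw [abs_mul, abs_of_pos (by norm_num : (0 : ℝ) < 1 / 2)]
        calc 1 / 2 * |J - I| ≤ 1 / 2 * (κ * (2 * Real.pi * |ε|)) := by gcongr
          _ = κ * |Real.pi * ε| := by rw [abs_mul, abs_of_pos hpi]; ring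
          _ ≤ _ := by gcongr
      have h4 : (4 * D + 4 * κ * D) / N = 4 * (D / N) + κ * (4 * (D / N)) := by ring
      rw [h4]
      exact add_le_add (h1.trans hπε) h3
    rw [abs_mul, abs_of_pos (one_div_pos.mpr hμ0), one_div_mul_eq_div, pow_two, ← div_div]
    gcongr
  have b3 : |(1 / μ - 1 / (N + 1 / 4)) * (1 + 1 / 2 * I)| ≤ D * (1 + κ) / N ^ 2 := by
    have h1 := abs_one_div_sub_one_div_le (hN.trans hμN') (by linarith : 1 ≤ (N : ℝ) + 1 / 4)
    have h2 : μ - (N + 1 / 4) = ε := by rw [hμ]; ring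
    rw [h2] at h1
    have h3 : |1 + 1 / 2 * I| ≤ 1 + κ := by
      have := abs_le.mp hIκ
      exact abs_le.mpr ⟨by linarith, by linarith⟩
    rw [abs_mul]
    calc _ ≤ (D / N / N) * (1 + κ) := by
          refine mul_le_mul (h1.trans ?_) h3 (abs_nonneg _) (by positivity)
          gcongr
      _ = _ := by ring
  have b4 : |1 / μ * r| ≤ K / N ^ 2 := by
    rw [abs_mul, abs_of_pos (one_div_pos.mpr hμ0), one_div_mul_eq_div, pow_two, ← div_div]
    gcongr
  -- Exact splitting of the error into linearising the sine, freezing the bracket at ε = 0,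
  -- replacing 1/μ by 1/(N + 1/4), and the remainder of E; each is O(1/N²) by `b1` to `b4`.
  have hid : Real.pi * (N + 1 / 4 + ε - (N + 1 / 4 - 2 / (Real.pi * (4 * N + 1)) * (2 + I))) =
      (Real.pi * ε - Real.sin (Real.pi * ε)) -
      1 / μ * ((Real.cos (Real.pi * ε) - 1) + 1 / 2 * (J - I)) -
      (1 / μ - 1 / (N + 1 / 4)) * (1 + 1 / 2 * I) - 1 / μ * r := by
    have h1 : Real.pi * (N + 1 / 4 + ε - (N + 1 / 4 - 2 / (Real.pi * (4 * N + 1)) * (2 + I))) =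
        Real.pi * ε + 1 / (N + 1 / 4) * (1 + 1 / 2 * I) := by
      have : (4 * (N : ℝ) + 1) ≠ 0 := by positivity
      have : (N : ℝ) + 1 / 4 ≠ 0 := by positivity
      field_simp
      ring
    rw [h1]
    linear_combination hsin
  have hfin : |Real.pi * (N + 1 / 4 + ε -
      (N + 1 / 4 - 2 / (Real.pi * (4 * N + 1)) * (2 + I)))| ≤
      (16 * D ^ 2 + (4 * D + 4 * κ * D) + D * (1 + κ) + K) * (1 / N ^ 2) := by
    have h1 : (16 * D ^ 2 + (4 * D + 4 * κ * D) + D * (1 + κ) + K) * (1 / (N : ℝ) ^ 2) =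
        16 * D ^ 2 / N ^ 2 + (4 * D + 4 * κ * D) / N ^ 2 + D * (1 + κ) / N ^ 2 + K / N ^ 2 := by
      ring
    rw [hid, h1]
    rw [abs_le] at b1 b2 b3 b4 ⊢
    constructor <;> linarith
  refine le_trans ?_ hfin
  rw [abs_mul, abs_of_pos hpi]
  exact le_mul_of_one_le_left (abs_nonneg _) (by linarith)

end Asymptotics

/-! ### Conclusion. -/

theorem RetardedProblem.integral_potential_mul_cos (P : RetardedProblem) (m : ℝ) :
    ∫ τ in (0 : ℝ)..Real.pi, P.potential τ * Real.cos (m * (τ - P.argument τ)) =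
      ∫ τ in (0 : ℝ)..Real.pi, P.q τ * Real.cos (m * P.Δ τ) := by
  refine intervalIntegral.integral_congr_ae ?_
  have hnull : ∀ᵐ τ : ℝ, τ ∉ ({P.h₁, P.h₂} : Set ℝ) :=
    (Set.toFinite ({P.h₁, P.h₂} : Set ℝ)).countable.ae_notMem _
  filter_upwards [hnull] with τ hτ hmem
  rw [uIoc_of_le Real.pi_pos.le] at hmem
  have hd : τ ∈ P.domain := by
    rw [P.domain_eq]
    exact ⟨Ioc_subset_Icc_self hmem, hτ⟩
  rw [P.potential_of_mem hd, P.argument_of_mem hd, sub_sub_cancel]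

theorem theorem4 (P : RetardedProblem) (ha : P.ConditionA) (hb : P.ConditionB) :
    ∃ μ : ℕ → ℝ, (∀ᶠ N in atTop, P.IsTheEigenvalueNear N (μ N)) ∧
      (fun N : ℕ => μ N - ((N : ℝ) + 1 / 4 - 2 / (Real.pi * (4 * (N : ℝ) + 1)) *
        (2 + ∫ τ in (0 : ℝ)..Real.pi,
          P.q τ * Real.cos (((N : ℝ) + 1 / 4) * P.Δ τ)))) =O[atTop]
        (fun N : ℕ => 1 / (N : ℝ) ^ 2) := by
  classical
  have hQ := ha.integrable_potential
  have hσ := P.measurable_argument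
  have hmap := P.argument_mem
  obtain ⟨K, hK0, hK⟩ := RetardedProblem.abs_charRemainder_sub_le ha hb
  obtain ⟨κ, hκ⟩ : ∃ κ, κ = ∫ t, |P.potential t| := ⟨_, rfl⟩
  have hκ0 : 0 ≤ κ := by
    rw [hκ]
    exact MeasureTheory.integral_nonneg fun t => abs_nonneg _
  rw [← hκ] at hK
  -- A common bound and Lipschitz constant for `E`; moreover 2C < N ≤ μ forces μ ≥ 1 and μ ≥ 2κ.
  obtain ⟨C, hC⟩ : ∃ C, C = 100 * κ + 10 := ⟨_, rfl⟩
  -- A solution is chosen for every real μ so that `E` is a function on ℝ; for small μ the choice is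
  -- irrelevant, as it is for small N in `hμex`.
  have hex : ∀ μ, ∃ z, 0 < μ → 2 * κ ≤ μ →
      IsVolterraSolution P.potential P.argument μ 1 z := fun μ => by
    by_cases h : 0 < μ ∧ 2 * κ ≤ μ
    · rw [hκ] at h
      obtain ⟨z, hz⟩ := exists_isVolterraSolution hQ hσ h.1 h.2
      exact ⟨z, fun _ _ => hz⟩
    · exact ⟨0, fun h1 h2 => absurd ⟨h1, h2⟩ h⟩
  choose z hz using hex
  obtain ⟨E, hE⟩ : ∃ E : ℝ → ℝ, E = fun μ => charRemainder P.potential P.argument μ (z μ) :=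
    ⟨_, rfl⟩
  have hlarge : ∀ N : ℕ, 2 * C < N → ∀ μ, (N : ℝ) ≤ μ → 1 ≤ μ ∧ 2 * κ ≤ μ :=
    fun N hN μ hμ => ⟨by linarith, by linarith⟩
  have hEb : ∀ N : ℕ, 2 * C < N → ∀ μ, (N : ℝ) ≤ μ → |E μ| ≤ C := fun N hN μ hμ => by
    obtain ⟨h1, h2⟩ := hlarge N hN μ hμ
    have h3 := (hz μ (by linarith) h2).abs_charRemainder_le hQ hmap h1 (hκ ▸ h2)
    rw [← hκ] at h3
    rw [hE]
    exact h3.trans (by linarith)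
  have hEL : ∀ N : ℕ, 2 * C < N → ∀ μ ν, (N : ℝ) ≤ μ → (N : ℝ) ≤ ν →
      |E μ - E ν| ≤ C * |μ - ν| := fun N hN μ ν hμ hν => by
    obtain ⟨h1, h2⟩ := hlarge N hN μ hμ
    obtain ⟨h3, h4⟩ := hlarge N hN ν hν
    have h5 := (hz μ (by linarith) h2).abs_charRemainder_sub_le (hz ν (by linarith) h4) hQ hσ hmap
      h1 (hκ ▸ h2) h3 (hκ ▸ h4)
    rw [← hκ, ← hC] at h5
    rw [hE]
    exact h5
  have hiff : ∀ N : ℕ, 2 * C < N → ∀ μ, (N : ℝ) ≤ μ → (P.IsEigenvalue μ ↔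
      Real.cos (μ * Real.pi) - Real.sin (μ * Real.pi) - E μ / μ = 0) := fun N hN μ hμ => by
    obtain ⟨h1, h2⟩ := hlarge N hN μ hμ
    rw [hE]
    exact RetardedProblem.isEigenvalue_iff hQ (by linarith) (hκ ▸ h2) (hz μ (by linarith) h2)
  have hge : ∀ (N : ℕ) (μ : ℝ), |(N : ℝ) + 1 / 4 - μ| < 1 / 4 → (N : ℝ) ≤ μ := fun N μ h => by
    linarith [(abs_lt.mp h).2]
  have hμex : ∀ N : ℕ, ∃ μ, 2 * C < N → |(N : ℝ) + 1 / 4 - μ| < 1 / 4 ∧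
      Real.cos (μ * Real.pi) - Real.sin (μ * Real.pi) - E μ / μ = 0 := fun N => by
    by_cases hN : 2 * C < N
    · obtain ⟨μ, hμ⟩ := exists_zero_near (by linarith) hN (hEb N hN) (hEL N hN)
      exact ⟨μ, fun _ => hμ⟩
    · exact ⟨0, fun h => absurd h hN⟩
  choose μ hμ using hμex
  have hev : ∀ᶠ N : ℕ in atTop, 2 * C < N :=
    tendsto_natCast_atTop_atTop.eventually (eventually_gt_atTop (2 * C))
  refine ⟨μ, ?_, ?_⟩
  · filter_upwards [hev] with N hN
    obtain ⟨h1, h2⟩ := hμ N hN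
    refine ⟨⟨(hiff N hN _ (hge N _ h1)).mpr h2, h1⟩, fun ν hν hν1 => ?_⟩
    exact zero_near_unique (by linarith) hN (hEb N hN) (hEL N hN) h1 hν1 h2
      ((hiff N hN ν (hge N ν hν1)).mp hν)
  · obtain ⟨B, hB⟩ := abs_zero_near_sub_le (ρ := fun τ => τ - P.argument τ) hQ (by fun_prop)
      (fun t ht => abs_le.mpr ⟨by linarith [ht.1, (hmap t).2], by linarith [ht.2, (hmap t).1]⟩) hK0
    refine IsBigO.of_bound B ?_
    filter_upwards [hev] with N hN
    obtain ⟨h1, h2⟩ := hμ N hN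
    obtain ⟨h3, h4⟩ := hlarge N hN _ (hge N _ h1)
    have h5 := hB N (μ N) (E (μ N)) (by linarith) h1
      (by
        rw [hE]
        exact hK (μ N) (by linarith) h4 _ (hz (μ N) (by linarith) h4)) h2
    rw [P.integral_potential_mul_cos] at h5
    rw [Real.norm_eq_abs, Real.norm_of_nonneg (by positivity)]
    exact h5
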